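/- Let $n\ge 0$ and $k\ge 0$ be integers, and equip $\mathbb{R}^{2n}$, with coordinates $(x_1,\dots,x_n,y_1,\dots,y_n)$, with the Euclidean norm $|\cdot|$ and the symplectic form $\omega_0=\sum_i dx_i\wedge dy_i$. A normalized Hamiltonian on $\mathbb{R}^{2n}\times[a,b]$ is a smooth function $F$ such that the supports of all $F_t=F(\cdot,t)$, $t\in[a,b]$, lie in one compact set; its Hamiltonian vector field is given by $i_{X_{F_t}}\omega_0=-dF_t$. Let $\mathrm{Ham}(\mathbb{R}^{2n},\omega_0)$ be the group of time-one maps of the flows, starting at the identity, of normalized Hamiltonians on $\mathbb{R}^{2n}\times[0,1]$. For a continuous, piecewise smooth path $f:[0,1]\to\mathrm{Ham}(\mathbb{R}^{2n},\omega_0)$ with division $0=t_0<t_1<\dots<t_N=1$, whose smooth pieces are generated by normalized Hamiltonians $F^l$ on $\mathbb{R}^{2n}\times[t_{l-1},t_l]$, i.e. $\frac{d}{dt}f_t(z)=X_{F^l_t}(f_t(z))$ for $t\in[t_{l-1},t_l]$, put $$\mathrm{Length}^*_k(f)=\sum_{i=0}^k\ \max_{1\le l\le N}\ \max_{t_{l-1}\le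 t\le t_l}\Bigl(\max_z\frac{\partial^iF^l}{\partial t^i}(z,t)-\min_z\frac{\partial^iF^l}{\partial t^i}(z,t)\Bigr).$$ Let $d_k^*(\varphi,\psi)$ be the infimum of $\mathrm{Length}_k^*(f)$ over all such paths from $\varphi$ to $\psi$, and let $\|\varphi\|_k^*=d_k^*(\varphi,\mathrm{id})$. Write $\mathrm{supp}(\varphi)=\overline{\{z:\varphi(z)\ne z\}}$ and $|\varphi-\psi|_{C^0}=\sup_z|\varphi(z)-\psi(z)|$. **Theorem.** For every $k\ge0$ there is a constant $$C\le 2^{3k+8}(k+1)^2\bigl(1+2^{k+1}+2^{2k+2}+2^{3k+3}\bigr)$$ such that for all $n$ and all $\varphi,\psi\in\mathrm{Ham}(\mathbb{R}^{2n},\omega_0)$, $$d_k^*(\varphi,\psi)=\|\varphi\psi^{-1}\|_k^*\le C\,\mathrm{diam}\bigl(\mathrm{supp}(\varphi\psi^{-1})\bigr)\,|\varphi-\psi|_{C^0}.$$ For $k=0$ one can take $C=128$. -/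

import Mathlib

open scoped ContDiff

noncomputable section

namespace HamGeom

/-- The Euclidean space `ℝ²ⁿ`; the coordinates are `x i = z (Sum.inl i)`, `y i = z (Sum.inr i)`,
and the norm is the Euclidean one. -/
abbrev E (n : ℕ) : Type := EuclideanSpace ℝ (Fin n ⊕ Fin n)

/-- The standard symplectic form `ω₀ = ∑ i, dx i ∧ dy i`. -/
def omega0 {n : ℕ} (u v : E n) : ℝ :=
  ∑ i : Fin n, (u (Sum.inl i) * v (Sum.inr i) - u (Sum.inr i) * v (Sum.inl i))

/-- The Hamiltonian vector field of `G : ℝ²ⁿ → ℝ`, namely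
`X_G = ∑ i, (-(∂G/∂y i) ∂/∂x i + (∂G/∂x i) ∂/∂y i)`; see `omega0_hamVF`. -/
def hamVF {n : ℕ} (G : E n → ℝ) (z : E n) : E n :=
  WithLp.toLp 2 (Sum.elim
    (fun i => -(fderiv ℝ G z (EuclideanSpace.single (Sum.inr i) 1)))
    (fun i => fderiv ℝ G z (EuclideanSpace.single (Sum.inl i) 1)))

/-- `hamVF G` is the vector field with `i_{X_G} ω₀ = -dG`. -/
theorem omega0_hamVF {n : ℕ} (G : E n → ℝ) (z w : E n) :
    omega0 (hamVF G z) w = -(fderiv ℝ G z w) := by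
  have hw : w = ∑ j : Fin n ⊕ Fin n, w j • EuclideanSpace.single j (1 : ℝ) := by
    ext a
    rcases a with a | a <;> simp [Finset.sum_apply, Pi.single_apply, WithLp.ofLp_sum]
  conv_rhs => rw [hw]
  rw [map_sum, Fintype.sum_sum_type, omega0, neg_add, ← Finset.sum_neg_distrib,
    ← Finset.sum_neg_distrib, ← Finset.sum_add_distrib]
  refine Finset.sum_congr rfl fun i _ => ?_
  simp [hamVF]
  ring

/-- A normalized time-dependent Hamiltonian function on `ℝ²ⁿ × [a, b]`: it is smooth there (up to
the end points), and the supports of all `F (·, t)` lie in one compact set. -/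
def IsNormalized {n : ℕ} (a b : ℝ) (F : E n → ℝ → ℝ) : Prop :=
  ContDiffOn ℝ ∞ (fun p : E n × ℝ => F p.1 p.2) (Set.univ ×ˢ Set.Icc a b) ∧
    ∃ K : Set (E n), IsCompact K ∧ ∀ t ∈ Set.Icc a b, tsupport (fun z => F z t) ⊆ K

/-- The family of maps `f t`, `t ∈ [a, b]`, is generated by `F`:
`(d/dt) f t z = X_{F t} (f t z)` for all `z` and all `t ∈ [a, b]`. -/
def IsGeneratedBy {n : ℕ} (a b : ℝ) (f : ℝ → E n → E n) (F : E n → ℝ → ℝ) : Prop :=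
  ∀ z : E n, ∀ t ∈ Set.Icc a b,
    HasDerivWithinAt (fun s => f s z) (hamVF (fun y => F y t) (f t z)) (Set.Icc a b) t

/-- `Ham(ℝ²ⁿ, ω₀)`: the bijections of `ℝ²ⁿ` that are time-one maps of the flow, starting from the
identity, of a normalized Hamiltonian on `ℝ²ⁿ × [0, 1]`. (Time-one maps of such flows are
automatically compactly supported diffeomorphisms.) -/
def Ham (n : ℕ) : Set (Equiv.Perm (E n)) :=
  {φ | ∃ (F : E n → ℝ → ℝ) (f : ℝ → E n → E n), IsNormalized 0 1 F ∧ IsGeneratedBy 0 1 f F ∧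
    f 0 = id ∧ f 1 = φ}

/-- A continuous, piecewise smooth path `t ↦ path t`, `t ∈ [0, 1]`, in `Ham(ℝ²ⁿ, ω₀)` from `φ` to
`ψ`, with a division `0 = time 0 < time 1 < ⋯ < time N = 1` into smooth pieces and with the
normalized Hamiltonian functions `F l` that generate the pieces. Consecutive closed pieces share
their common end point, so the path is continuous; the values of `path t` for `t` outside
`[0, 1]` play no role. -/
structure HamPath {n : ℕ} (φ ψ : Equiv.Perm (E n)) where
  N : ℕ
  time : Fin (N + 1) → ℝ
  time_strictMono : StrictMono time
  time_zero : time 0 = 0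
  time_last : time (Fin.last N) = 1
  path : ℝ → Equiv.Perm (E n)
  path_mem : ∀ t ∈ Set.Icc (0 : ℝ) 1, path t ∈ Ham n
  path_zero : path 0 = φ
  path_one : path 1 = ψ
  path_smooth : ∀ l : Fin N, ContDiffOn ℝ ∞ (fun p : E n × ℝ => path p.2 p.1)
    (Set.univ ×ˢ Set.Icc (time l.castSucc) (time l.succ))
  F : Fin N → E n → ℝ → ℝ
  F_normalized : ∀ l : Fin N, IsNormalized (time l.castSucc) (time l.succ) (F l)
  F_generates : ∀ l : Fin N,
    IsGeneratedBy (time l.castSucc) (time l.succ) (fun t => path t) (F l)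

/-- `‖G‖_∞ = max G - min G`. -/
def osc {n : ℕ} (G : E n → ℝ) : ℝ := (⨆ z, G z) - ⨅ z, G z

/-- The coarse `k`-length of a path,
`∑_{i ≤ k} max_l max_{t ∈ [time (l-1), time l]} ‖∂ⁱ(F l)/∂tⁱ (·, t)‖_∞`,
with one-sided time derivatives at the end points of each piece. -/
def HamPath.lengthStar {n : ℕ} {φ ψ : Equiv.Perm (E n)} (γ : HamPath φ ψ) (k : ℕ) : ENNReal :=
  ∑ i ∈ Finset.range (k + 1),
    ⨆ l : Fin γ.N, ⨆ t ∈ Set.Icc (γ.time l.castSucc) (γ.time l.succ),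
      ENNReal.ofReal (osc fun z =>
        iteratedDerivWithin i (fun s => γ.F l z s)
          (Set.Icc (γ.time l.castSucc) (γ.time l.succ)) t)

/-- The quasimetric `d*_k(φ, ψ)`: the infimum of the coarse `k`-lengths of all continuous,
piecewise smooth paths in `Ham(ℝ²ⁿ, ω₀)` from `φ` to `ψ` (it is `⊤` if there is none). -/
def dStar {n : ℕ} (k : ℕ) (φ ψ : Equiv.Perm (E n)) : ENNReal :=
  ⨅ γ : HamPath φ ψ, γ.lengthStar k

/-- The quasinorm `‖φ‖*_k = d*_k(φ, id)`. -/
def normStar {n : ℕ} (k : ℕ) (φ : Equiv.Perm (E n)) : ENNReal := dStar k φ 1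

/-- The support of a map: the closure of the set of points that it moves. -/
def supp {n : ℕ} (φ : Equiv.Perm (E n)) : Set (E n) := closure {z | φ z ≠ z}

/-- `|φ - ψ|_{C⁰} = sup_z |φ(z) - ψ(z)|`. -/
def distC0 {n : ℕ} (φ ψ : Equiv.Perm (E n)) : ℝ := ⨆ z, ‖φ z - ψ z‖

end HamGeom

end

/-! Let θ = ψφ⁻¹, let δ be the C⁰-distance of φ and ψ and D the diameter of the support. Then θ
moves points by at most δ and is supported in a ball of radius D. The path from φ to θφ is built
from seven Hamiltonian isotopies, each of which either is autonomous with oscillation at most a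
constant times Dδ, or has arbitrarily small oscillations in all time derivatives up to order `k`.
Autonomous pieces contribute nothing to the orders i ≥ 1, so one constant, 128, serves for every
`k`.

Dilation (`exists_small_isotopy`). Conjugating θ by the dilation with factor c gives a map θ_c that
moves points by at most cδ. As c runs from ε to 1, θ_c θ_ε⁻¹ is an isotopy from the identity to θ
θ_ε⁻¹ that stays C⁰-small throughout; its Hamiltonian comes from the action function of θ
(`exists_action`). The remainder θ_ε has a Hamiltonian multiplied by ε² and is cheap.

Fragmentation (`exists_fragmentation`). Cutting off the Hamiltonian of this C⁰-small isotopy along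
parallel strips of period W = 6δ splits it into f₁ f₂, with each factor supported in a family of
disjoint strips inside the ball.

Displacement (`exists_displacement`). An autonomous g with oscillation about DW moves all the strips
by more than 2D along themselves, so it carries the support U successively to disjoint copies. Place
the intermediate maps of an isotopy ending at f on these copies to form Φ, and its N short pieces to
form Ψ. A telescoping argument (`eq_commutator_mul`) gives f = (Φ g Φ⁻¹) g⁻¹ Ψ. However wild Φ is, Φ
g Φ⁻¹ is autonomous with the oscillation of g, while Ψ has oscillations of order 1/N because
disjoint supports take a maximum, not a sum.

`dStar_flow_mul_le` concatenates the pieces. The preparatory ODE theory gives global smooth flows of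
compactly supported fields and shows that Hamiltonian flows are symplectic. -/

noncomputable section

namespace HamGeom

open Set Filter Topology

universe u

/-! ### Composition operators on spaces of continuous functions -/

section Nemytskii

variable {X : Type*} [TopologicalSpace X] [CompactSpace X]
  {F G : Type u} [NormedAddCommGroup F] [NormedSpace ℝ F] [NormedAddCommGroup G] [NormedSpace ℝ G]

/-- Pointwise application of a continuous family of operators to a continuous function. -/
def pointwiseApply (X : Type*) [TopologicalSpace X] [CompactSpace X]
    (F G : Type u) [NormedAddCommGroup F] [NormedSpace ℝ F] [NormedAddCommGroup G]
    [NormedSpace ℝ G] : C(X, F →L[ℝ] G) →L[ℝ] C(X, F) →L[ℝ] C(X, G) :=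
  LinearMap.mkContinuous₂
    (LinearMap.mk₂ ℝ (fun (A : C(X, F →L[ℝ] G)) (h : C(X, F)) =>
        (⟨fun x => A x (h x), by fun_prop⟩ : C(X, G)))
      (fun A B h => by ext x; simp) (fun c A h => by ext x; simp)
      (fun A h k => by ext x; simp) (fun c A h => by ext x; simp)) 1
    (fun A h => by
      rw [ContinuousMap.norm_le _ (by positivity)]
      intro x
      simp only [LinearMap.mk₂_apply, ContinuousMap.coe_mk, one_mul]
      exact (ContinuousLinearMap.le_opNorm _ _).trans
        (mul_le_mul (A.norm_coe_le_norm x) (h.norm_coe_le_norm x) (norm_nonneg _)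
          (norm_nonneg A)))

/-- Composition with a `C¹` map is differentiable on the space of continuous functions. -/
theorem hasFDerivAt_comp_continuousMap {v : F → G} (hv : ContDiff ℝ 1 v) (g : C(X, F)) :
    HasFDerivAt (fun g : C(X, F) => (⟨v, hv.continuous⟩ : C(F, G)).comp g)
      (pointwiseApply X F G
        ((⟨fderiv ℝ v, hv.continuous_fderiv one_ne_zero⟩ : C(F, F →L[ℝ] G)).comp g)) g := by
  rw [hasFDerivAt_iff_isLittleO_nhds_zero, Asymptotics.isLittleO_iff]
  intro ε hε
  have hK : IsCompact (range g) := isCompact_range g.continuous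
  have hu := hK.uniformContinuousAt_of_continuousAt (fderiv ℝ v)
    (fun a _ => (hv.continuous_fderiv one_ne_zero).continuousAt) (Metric.dist_mem_uniformity hε)
  obtain ⟨δ, hδ, hd⟩ := Metric.mem_uniformity_dist.1 hu
  filter_upwards [Metric.ball_mem_nhds (0 : C(X, F)) hδ] with h hh
  rw [mem_ball_zero_iff] at hh
  rw [ContinuousMap.norm_le _ (by positivity)]
  intro x
  have hx : ‖h x‖ ≤ ‖h‖ := h.norm_coe_le_norm x
  have key : ‖v (g x + h x) - v (g x) - fderiv ℝ v (g x) (g x + h x - g x)‖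
      ≤ ε * ‖g x + h x - g x‖ := by
    refine (convex_ball (g x) δ).norm_image_sub_le_of_norm_fderiv_le' (𝕜 := ℝ)
      (fun y _ => (hv.differentiable one_ne_zero) y) (fun y hy => ?_)
      (Metric.mem_ball_self hδ) ?_
    · have := hd (show dist (g x) y < δ by rw [dist_comm]; exact hy) (mem_range_self x)
      rw [← dist_eq_norm, dist_comm]
      exact this.le
    · simpa [Metric.mem_ball, dist_eq_norm] using hx.trans_lt hh
  rw [add_sub_cancel_left] at key
  exact key.trans (mul_le_mul_of_nonneg_left hx hε.le)

/-- The derivative is again a composition operator, now with `fderiv ℝ v`. The induction therefore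
replaces `G` by `F →L[ℝ] G`, which is why `G` is quantified inside and shares the universe of `F`.
-/
theorem contDiff_comp_continuousMap_nat (n : ℕ) : ∀ {G : Type u} [NormedAddCommGroup G]
    [NormedSpace ℝ G] {v : F → G} (hv : ContDiff ℝ n v),
    ContDiff ℝ n (fun g : C(X, F) => (⟨v, hv.continuous⟩ : C(F, G)).comp g) := by
  induction n with
  | zero =>
    intro G _ _ v hv
    simp only [Nat.cast_zero, contDiff_zero]
    exact ContinuousMap.continuous_postcomp _
  | succ n ih =>
    intro G _ _ v hv
    have h1 : ContDiff ℝ 1 v := hv.of_le (by norm_cast; omega)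
    have h2 : ContDiff ℝ n (fderiv ℝ v) := by
      push_cast at hv
      exact (contDiff_succ_iff_fderiv.1 hv).2.2
    push_cast
    rw [contDiff_succ_iff_hasFDerivAt]
    have h3 := (pointwiseApply X F G).contDiff (n := n) |>.comp (ih h2)
    exact ⟨fun g => pointwiseApply X F G ((⟨fderiv ℝ v, h2.continuous⟩ : C(F, F →L[ℝ] G)).comp g),
      h3, fun g => hasFDerivAt_comp_continuousMap h1 g⟩

/-- Composition with a smooth map is smooth on the space of continuous functions. -/
theorem contDiff_comp_continuousMap {v : F → G} (hv : ContDiff ℝ ∞ v) :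
    ContDiff ℝ ∞ (fun g : C(X, F) => (⟨v, hv.continuous⟩ : C(F, G)).comp g) :=
  contDiff_infty.2 fun n => contDiff_comp_continuousMap_nat n (contDiff_infty.1 hv n)

end Nemytskii

/-! ### Integration as a bounded operator -/

section Integration

variable {F : Type u} [NormedAddCommGroup F] [NormedSpace ℝ F] [CompleteSpace F]

theorem hasDerivAt_integral_projIcc (g : C(Icc (0 : ℝ) 1, F)) (t : ℝ) :
    HasDerivAt (fun t => ∫ s in (0 : ℝ)..t, g (projIcc 0 1 zero_le_one s))
      (g (projIcc 0 1 zero_le_one t)) t :=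
  intervalIntegral.integral_hasDerivAt_right
    ((by fun_prop : Continuous fun s => g (projIcc (0 : ℝ) 1 zero_le_one s)).intervalIntegrable _ _)
    ((by fun_prop : Continuous fun s => g (projIcc (0 : ℝ) 1 zero_le_one s)).stronglyMeasurableAtFilter
      _ _)
    (by fun_prop : Continuous fun s => g (projIcc (0 : ℝ) 1 zero_le_one s)).continuousAt

/-- The operator `g ↦ (t ↦ ∫₀ᵗ g)` on the continuous functions on `[0, 1]`. -/
def integralCLM (F : Type u) [NormedAddCommGroup F] [NormedSpace ℝ F] [CompleteSpace F] :
    C(Icc (0 : ℝ) 1, F) →L[ℝ] C(Icc (0 : ℝ) 1, F) :=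
  LinearMap.mkContinuous
    { toFun := fun g => ⟨fun t => ∫ s in (0 : ℝ)..t, g (projIcc 0 1 zero_le_one s),
        (continuous_iff_continuousAt.2 fun t =>
          (hasDerivAt_integral_projIcc g t).continuousAt).comp continuous_subtype_val⟩
      map_add' := fun g h => by
        ext t
        simp only [ContinuousMap.add_apply, ContinuousMap.coe_mk]
        exact intervalIntegral.integral_add
          ((by fun_prop : Continuous fun s => g (projIcc (0 : ℝ) 1 zero_le_one s)).intervalIntegrable
            _ _)
          ((by fun_prop : Continuous fun s => h (projIcc (0 : ℝ) 1 zero_le_one s)).intervalIntegrable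
            _ _)
      map_smul' := fun c g => by
        ext t
        simp } 1
    (fun g => by
      rw [ContinuousMap.norm_le _ (by positivity)]
      intro t
      simp only [LinearMap.coe_mk, AddHom.coe_mk, ContinuousMap.coe_mk, one_mul]
      refine (intervalIntegral.norm_integral_le_of_norm_le_const
        (fun s _ => g.norm_coe_le_norm _)).trans ?_
      rw [sub_zero, abs_of_nonneg t.2.1]
      exact mul_le_of_le_one_right (norm_nonneg _) t.2.2)

end Integration

/-! ### Uniqueness and smooth dependence for autonomous equations -/

section Flow

variable {F : Type u} [NormedAddCommGroup F] [NormedSpace ℝ F]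

/-- Two solutions of `c' = v c` on `[0, T]` with a `C¹` vector field `v` that start at the same
point are equal. -/
theorem eqOn_of_hasDerivWithinAt {v : F → F} (hv : ContDiff ℝ 1 v) {T : ℝ} {c d : ℝ → F}
    (hc : ∀ t ∈ Icc 0 T, HasDerivWithinAt c (v (c t)) (Icc 0 T) t)
    (hd : ∀ t ∈ Icc 0 T, HasDerivWithinAt d (v (d t)) (Icc 0 T) t) (h0 : c 0 = d 0) :
    EqOn c d (Icc 0 T) := by
  have hcc : ContinuousOn c (Icc 0 T) := fun t ht => (hc t ht).continuousWithinAt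
  have hdc : ContinuousOn d (Icc 0 T) := fun t ht => (hd t ht).continuousWithinAt
  -- The field is only locally Lipschitz; the compact union of the two curves supplies one Lipschitz
  -- constant.
  have hK : IsCompact (c '' Icc 0 T ∪ d '' Icc 0 T) :=
    (isCompact_Icc.image_of_continuousOn hcc).union (isCompact_Icc.image_of_continuousOn hdc)
  obtain ⟨K, hL⟩ := LocallyLipschitzOn.exists_lipschitzOnWith_of_compact hK
    (hv.locallyLipschitz.locallyLipschitzOn)
  refine ODE_solution_unique_of_mem_Icc_right (v := fun _ => v) (s := fun _ => _)
    (fun t _ => hL) hcc (fun t ht => ?_) (fun t ht => ?_) hdc (fun t ht => ?_) (fun t ht => ?_) h0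
  · exact (hc t (Ico_subset_Icc_self ht)).mono_of_mem_nhdsWithin (Icc_mem_nhdsGE_of_mem ht)
  · exact Or.inl (mem_image_of_mem _ (Ico_subset_Icc_self ht))
  · exact (hd t (Ico_subset_Icc_self ht)).mono_of_mem_nhdsWithin (Icc_mem_nhdsGE_of_mem ht)
  · exact Or.inr (mem_image_of_mem _ (Ico_subset_Icc_self ht))

/-- Integral curves of a `C¹` vector field on an open interval around `0` are determined by their
value at `0`. -/
theorem eq_of_hasDerivAt_Ioo {v : F → F} (hv : ContDiff ℝ 1 v) {c d : ℝ → F} {T : ℝ}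
    (hc : ∀ t ∈ Ioo (-T) T, HasDerivAt c (v (c t)) t)
    (hd : ∀ t ∈ Ioo (-T) T, HasDerivAt d (v (d t)) t) (h0 : c 0 = d 0) {t : ℝ}
    (ht : t ∈ Ioo (-T) T) : c t = d t := by
  obtain ⟨h1, h2⟩ := ht
  rcases le_total 0 t with ht | ht
  · exact eqOn_of_hasDerivWithinAt hv
      (fun s hs => (hc s ⟨by linarith [hs.1], by linarith [hs.2]⟩).hasDerivWithinAt)
      (fun s hs => (hd s ⟨by linarith [hs.1], by linarith [hs.2]⟩).hasDerivWithinAt) h0 ⟨ht, le_rfl⟩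
  · have key : ∀ {c : ℝ → F}, (∀ t ∈ Ioo (-T) T, HasDerivAt c (v (c t)) t) → ∀ s ∈ Icc 0 (-t),
        HasDerivAt (fun s => c (-s)) ((fun x => -v x) (c (-s))) s := fun {c} hc s hs => by
      simpa [Function.comp_def] using
        (hc (-s) ⟨by linarith [hs.2], by linarith [hs.1]⟩).scomp s (hasDerivAt_neg s)
    have := eqOn_of_hasDerivWithinAt (T := -t) hv.neg
      (fun s hs => (key hc s hs).hasDerivWithinAt)
      (fun s hs => (key hd s hs).hasDerivWithinAt) (by simpa using h0)
      ⟨neg_nonneg.2 ht, le_rfl⟩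
    simpa using this

/-- Integral curves of a `C¹` vector field that are defined on the whole line are determined by
their value at `0`. -/
theorem eq_of_hasDerivAt {v : F → F} (hv : ContDiff ℝ 1 v) {c d : ℝ → F}
    (hc : ∀ t, HasDerivAt c (v (c t)) t) (hd : ∀ t, HasDerivAt d (v (d t)) t) (h0 : c 0 = d 0)
    (t : ℝ) : c t = d t :=
  eq_of_hasDerivAt_Ioo hv (T := |t| + 1) (fun s _ => hc s) (fun s _ => hd s) h0
    ⟨by linarith [neg_abs_le t], by linarith [le_abs_self t]⟩

variable [CompleteSpace F]

/-- A family of integral curves of a smooth vector field is smooth near time `0`. -/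
theorem contDiffAt_flow_zero {v : F → F} (hv : ContDiff ℝ ∞ v) {Φ : F → ℝ → F}
    (h0 : ∀ x, Φ x 0 = x) (hΦ : ∀ x t, HasDerivAt (Φ x) (v (Φ x t)) t) (x₀ : F) :
    ContDiffAt ℝ ∞ (fun p : F × ℝ => Φ p.1 p.2) (x₀, 0) := by
  let I := Icc (0 : ℝ) 1
  let N : C(I, F) → C(I, F) := fun g => (⟨v, hv.continuous⟩ : C(F, F)).comp g
  have hN : ContDiff ℝ ∞ N := contDiff_comp_continuousMap hv
  let cst : F →L[ℝ] C(I, F) := ContinuousLinearMap.const ℝ I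
  -- A zero g of f((x, s), ·) is an orbit with time rescaled to [0, 1]: g(τ) = x + s ∫₀^τ v(g). At s
  -- = 0 the derivative in g is the identity, so the implicit function theorem yields a solution
  -- depending smoothly on (x, s).
  let f : (F × ℝ) × C(I, F) → C(I, F) := fun p => p.2 - cst p.1.1 - p.1.2 • integralCLM F (N p.2)
  have hf : ContDiff ℝ ∞ f := by
    refine (contDiff_snd.sub (cst.contDiff.comp (contDiff_fst.comp contDiff_fst))).sub
      ((contDiff_snd.comp contDiff_fst).smul
        ((integralCLM F).contDiff.comp (hN.comp contDiff_snd)))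
  set u : (F × ℝ) × C(I, F) := ((x₀, 0), cst x₀) with hu
  have hfu : f u = 0 := by simp [f, hu]
  have cdf : ContDiffAt ℝ ∞ f u := hf.contDiffAt
  have hinv : fderiv ℝ f u ∘L .inr ℝ (F × ℝ) C(I, F) = ContinuousLinearMap.id ℝ _ := by
    have h1 : HasFDerivAt (fun g : C(I, F) => f ((x₀, 0), g))
        (fderiv ℝ f u ∘L .inr ℝ (F × ℝ) C(I, F)) (cst x₀) :=
      ((hf.differentiable (by simp)) u).hasFDerivAt.comp (cst x₀)
        (hasFDerivAt_prodMk_right (x₀, (0 : ℝ)) (cst x₀))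
    have h2 : HasFDerivAt (fun g : C(I, F) => f ((x₀, 0), g)) (ContinuousLinearMap.id ℝ _)
        (cst x₀) := by
      simp only [f, zero_smul, sub_zero]
      exact (hasFDerivAt_id _).sub_const _
    exact h1.unique h2
  have if₂ : (fderiv ℝ f u ∘L .inr ℝ (F × ℝ) C(I, F)).IsInvertible := by
    rw [hinv]; exact ⟨ContinuousLinearEquiv.refl ℝ _, rfl⟩
  have hψ := cdf.contDiffAt_implicitFunction (by simp) if₂
  have hev := cdf.eventually_apply_implicitFunction (by simp) if₂
  set ψ := cdf.implicitFunction (by simp) if₂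
  have hsm : ContDiffAt ℝ ∞ (fun p : F × ℝ => ψ p ⟨1, zero_le_one, le_rfl⟩) (x₀, 0) :=
    (ContinuousMap.evalCLM ℝ (⟨1, zero_le_one, le_rfl⟩ : I)).contDiff.contDiffAt.fun_comp
      (x₀, (0 : ℝ)) hψ
  refine hsm.congr_of_eventuallyEq ?_
  filter_upwards [hev] with p hp
  rw [hfu] at hp
  have hp' : ∀ τ : I, ψ p τ = p.1 + p.2 • ∫ s in (0 : ℝ)..τ,
      v (ψ p (projIcc 0 1 zero_le_one s)) := fun τ => by
    have := DFunLike.congr_fun hp τ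
    simp only [f, ContinuousMap.sub_apply, ContinuousMap.smul_apply,
      ContinuousMap.zero_apply] at this
    rw [sub_sub, sub_eq_zero] at this
    exact this
  let c : ℝ → F := fun τ => p.1 + p.2 • ∫ s in (0 : ℝ)..τ, v (ψ p (projIcc 0 1 zero_le_one s))
  have hc : ∀ τ ∈ Icc (0 : ℝ) 1,
      HasDerivWithinAt c ((fun x => p.2 • v x) (c τ)) (Icc 0 1) τ := fun τ hτ => by
    have h1 := ((hasDerivAt_integral_projIcc (N (ψ p)) τ).const_smul p.2).const_add p.1
    have h2 : N (ψ p) (projIcc 0 1 zero_le_one τ) = v (c τ) := by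
      rw [projIcc_of_mem _ hτ]
      exact congrArg v (hp' ⟨τ, hτ⟩)
    rw [h2] at h1
    exact h1.hasDerivWithinAt
  have hd : ∀ τ ∈ Icc (0 : ℝ) 1, HasDerivWithinAt (fun τ => Φ p.1 (p.2 * τ))
      ((fun x => p.2 • v x) (Φ p.1 (p.2 * τ))) (Icc 0 1) τ := fun τ _ => by
    have : HasDerivAt (fun τ : ℝ => p.2 * τ) p.2 τ := by
      simpa using (hasDerivAt_id τ).const_mul p.2
    exact ((hΦ p.1 (p.2 * τ)).scomp τ this).hasDerivWithinAt
  have huniq := eqOn_of_hasDerivWithinAt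
    (((hv.const_smul p.2).of_le (by exact_mod_cast le_top)) : ContDiff ℝ 1 fun x => p.2 • v x)
    hc hd (by simp [c, h0]) (right_mem_Icc.2 zero_le_one)
  simp only [mul_one] at huniq
  rw [← huniq, hp']

omit [CompleteSpace F] in
/-- The group law of a flow. -/
theorem flow_add {v : F → F} (hv : ContDiff ℝ 1 v) {Φ : F → ℝ → F}
    (h0 : ∀ x, Φ x 0 = x) (hΦ : ∀ x t, HasDerivAt (Φ x) (v (Φ x t)) t) (x : F) (s t : ℝ) :
    Φ x (s + t) = Φ (Φ x s) t :=
  eq_of_hasDerivAt hv (c := fun t => Φ x (s + t)) (fun t => (hΦ x (s + t)).comp_const_add s t)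
    (hΦ _) (by simp [h0]) t

/-- A family of integral curves of a smooth vector field is a smooth map. -/
theorem contDiff_flow {v : F → F} (hv : ContDiff ℝ ∞ v) {Φ : F → ℝ → F}
    (h0 : ∀ x, Φ x 0 = x) (hΦ : ∀ x t, HasDerivAt (Φ x) (v (Φ x t)) t) :
    ContDiff ℝ ∞ (fun p : F × ℝ => Φ p.1 p.2) := by
  refine contDiff_infty.2 fun n => contDiff_iff_contDiffAt.2 fun ⟨x₀, t₀⟩ => ?_
  have hloc : ∀ y, ContDiffAt ℝ n (fun p : F × ℝ => Φ p.1 p.2) (y, 0) := fun y =>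
    (contDiffAt_flow_zero hv h0 hΦ y).of_le (by exact_mod_cast le_top)
  -- Being `ContDiffAt` of finite order is an open condition, which may fail for order ∞; hence the
  -- argument order by order.
  have hn : (n : WithTop ℕ∞) ≠ ∞ := by
    intro h
    exact absurd (WithTop.coe_injective h) (ENat.natCast_ne_top n)
  suffices h : {t | ContDiffAt ℝ n (fun p : F × ℝ => Φ p.1 p.2) (x₀, t)} = univ from
    (h.symm ▸ mem_univ t₀ : t₀ ∈ {t | ContDiffAt ℝ n (fun p : F × ℝ => Φ p.1 p.2) (x₀, t)})
  -- At a limit time t, take a good time s close to t and write Φ(x, t') = Φ(Φ(x, s), t' - s), where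
  -- t' - s is near 0.
  refine IsClopen.eq_univ ⟨isClosed_of_closure_subset fun t ht => ?_, ?_⟩ ⟨0, hloc x₀⟩
  · have hev := (hloc (Φ x₀ t)).eventually hn
    have hcont : Tendsto (fun s => (Φ x₀ s, t - s)) (𝓝 t) (𝓝 (Φ x₀ t, 0)) := by
      have h1 : ContinuousAt (fun s => (Φ x₀ s, t - s)) t :=
        (hΦ x₀ t).continuousAt.prodMk (by fun_prop)
      simpa [ContinuousAt] using h1
    obtain ⟨s, hs, hsm⟩ := ((mem_closure_iff_frequently.1 ht).and_eventually
      (hcont.eventually hev)).exists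
    have hs' : ContDiffAt ℝ n (fun p : F × ℝ => Φ p.1 s) (x₀, t) :=
      ContDiffAt.comp (x₀, t) (g := fun p : F × ℝ => Φ p.1 p.2) (f := fun p => (p.1, s))
        (show ContDiffAt ℝ n (fun p : F × ℝ => Φ p.1 p.2) (x₀, s) from hs) (by fun_prop)
    have := ContDiffAt.comp (x₀, t) (g := fun p : F × ℝ => Φ p.1 p.2)
      (f := fun p => (Φ p.1 s, p.2 - s)) hsm (hs'.prodMk (by fun_prop))
    refine this.congr_of_eventuallyEq (Eventually.of_forall fun p => ?_)
    have h := flow_add (hv.of_le (by exact_mod_cast le_top)) h0 hΦ p.1 s (p.2 - s)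
    simpa using h
  · refine isOpen_iff_mem_nhds.2 fun t ht => ?_
    have hc : Tendsto (fun s : ℝ => (x₀, s)) (𝓝 t) (𝓝 (x₀, t)) :=
      (by fun_prop : Continuous fun s : ℝ => (x₀, s)).continuousAt
    exact hc.eventually (ContDiffAt.eventually ht hn)

end Flow

/-! ### Global flows of compactly supported time-dependent fields -/

section TimeDependent

variable {F : Type u} [NormedAddCommGroup F] [NormedSpace ℝ F]

/-- The autonomous vector field on `F × ℝ` that belongs to a time-dependent vector field. -/
def suspension (X : F → ℝ → F) (p : F × ℝ) : F × ℝ := (X p.1 p.2, 1)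

theorem contDiff_suspension {X : F → ℝ → F} (hX : ContDiff ℝ ∞ fun p : F × ℝ => X p.1 p.2) :
    ContDiff ℝ ∞ (suspension X) := hX.prodMk contDiff_const

theorem fderiv_slice {G : Type*} [NormedAddCommGroup G] [NormedSpace ℝ G] {X : F → ℝ → G}
    (hX : ContDiff ℝ ∞ fun p : F × ℝ => X p.1 p.2) (z : F) (t : ℝ) :
    fderiv ℝ (fun y => X y t) z
      = (fderiv ℝ (fun p : F × ℝ => X p.1 p.2) (z, t)).comp (.inl ℝ F ℝ) := by
  have h1 : HasFDerivAt (fun p : F × ℝ => X p.1 p.2)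
      (fderiv ℝ (fun p : F × ℝ => X p.1 p.2) (z, t)) (z, t) :=
    (hX.differentiable (by simp) (z, t)).hasFDerivAt
  have h2 : HasFDerivAt (fun y : F => (y, t)) (.inl ℝ F ℝ) z := hasFDerivAt_prodMk_left z t
  exact (h1.comp z h2).fderiv

omit [NormedSpace ℝ F] in
theorem exists_bound_of_compact_support {G : Type*} [NormedAddCommGroup G] {X : F × ℝ → G}
    (hX : Continuous X) {K : Set F} (hK : IsCompact K) (h0 : ∀ t, ∀ z ∉ K, X (z, t) = 0)
    (a b : ℝ) : ∃ C : NNReal, ∀ z, ∀ t ∈ Icc a b, ‖X (z, t)‖ ≤ C := by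
  obtain ⟨C, hC⟩ := (hK.prod (isCompact_Icc (a := a) (b := b))).exists_bound_of_continuousOn
    hX.continuousOn
  refine ⟨C.toNNReal, fun z t ht => ?_⟩
  by_cases hz : z ∈ K
  · exact (hC (z, t) ⟨hz, ht⟩).trans (Real.le_coe_toNNReal C)
  · rw [h0 t z hz, norm_zero]; positivity

variable [CompleteSpace F]

/-- Solutions of `c' = X c t` exist on `[-T, T]` if `X` is compactly supported. -/
theorem exists_solution_Icc {X : F → ℝ → F} (hX : ContDiff ℝ ∞ fun p : F × ℝ => X p.1 p.2)
    {K : Set F} (hK : IsCompact K) (h0 : ∀ t, ∀ z ∉ K, X z t = 0) (x : F) {T : ℝ} (hT : 0 ≤ T) :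
    ∃ c : ℝ → F, c 0 = x ∧ ∀ t ∈ Icc (-T) T, HasDerivWithinAt c (X (c t) t) (Icc (-T) T) t := by
  obtain ⟨L, hL⟩ := exists_bound_of_compact_support hX.continuous hK h0 (-T) T
  have hd0 : ∀ t, ∀ z ∉ K,
      (fderiv ℝ (fun p : F × ℝ => X p.1 p.2) (z, t)).comp (.inl ℝ F ℝ) = 0 := fun t z hz => by
    rw [← fderiv_slice hX]
    have : (fun y => X y t) =ᶠ[𝓝 z] fun _ => 0 := by
      filter_upwards [hK.isClosed.isOpen_compl.mem_nhds hz] with y hy using h0 t y hy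
    rw [this.fderiv_eq]
    simp
  have hcont : Continuous fun p : F × ℝ =>
      (fderiv ℝ (fun p : F × ℝ => X p.1 p.2) p).comp (.inl ℝ F ℝ) :=
    (hX.continuous_fderiv (by simp)).clm_comp continuous_const
  obtain ⟨M, hM⟩ := exists_bound_of_compact_support hcont hK hd0 (-T) T
  -- The bound `L` holds on the whole space, so the radius L·T may be chosen freely and no smallness
  -- of T is needed.
  have hpl : IsPicardLindelof (fun t z => X z t) (tmin := -T) (tmax := T)
      ⟨0, by simpa using hT, hT⟩ x (L * T.toNNReal) 0 L M := by
    refine ⟨fun t ht => ?_, fun z _ => ?_, fun t ht z _ => hL z t ht, ?_⟩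
    · refine (lipschitzWith_of_nnnorm_fderiv_le (𝕜 := ℝ) (fun z => ?_) fun z => ?_).lipschitzOnWith
      · exact (hX.comp (contDiff_prodMk_left t)).differentiable (by simp) z
      · rw [fderiv_slice hX]
        exact_mod_cast hM z t ht
    · exact (hX.continuous.comp (by fun_prop : Continuous fun t : ℝ => (z, t))).continuousOn
    · simp [Real.coe_toNNReal T hT]
  exact hpl.exists_eq_forall_mem_Icc_hasDerivWithinAt₀

/-- Solutions of `c' = X c t` exist for all times if `X` is compactly supported. -/
theorem exists_solution {X : F → ℝ → F} (hX : ContDiff ℝ ∞ fun p : F × ℝ => X p.1 p.2)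
    {K : Set F} (hK : IsCompact K) (h0 : ∀ t, ∀ z ∉ K, X z t = 0) (x : F) :
    ∃ c : ℝ → F, c 0 = x ∧ ∀ t, HasDerivAt c (X (c t) t) t := by
  have hex : ∀ m : ℕ, ∃ c : ℝ → F, c 0 = x ∧
      ∀ t ∈ Ioo (-(m : ℝ)) m, HasDerivAt c (X (c t) t) t := fun m => by
    obtain ⟨c, h1, h2⟩ := exists_solution_Icc hX hK h0 x (Nat.cast_nonneg m)
    exact ⟨c, h1, fun t ht => (h2 t (Ioo_subset_Icc_self ht)).hasDerivAt (Icc_mem_nhds ht.1 ht.2)⟩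
  choose c hc0 hc using hex
  have huniq : ∀ {m k : ℕ}, m ≤ k → ∀ t ∈ Ioo (-(m : ℝ)) m, c m t = c k t := by
    intro m k hmk t ht
    have hmk' : (m : ℝ) ≤ k := by exact_mod_cast hmk
    have hv : ContDiff ℝ 1 (suspension X) :=
      (contDiff_suspension hX).of_le (by exact_mod_cast le_top)
    have := eq_of_hasDerivAt_Ioo hv (c := fun t => (c m t, t)) (d := fun t => (c k t, t))
      (fun t ht => (hc m t ht).prodMk (hasDerivAt_id t))
      (fun t ht => (hc k t ⟨by linarith [ht.1], by linarith [ht.2]⟩).prodMk (hasDerivAt_id t))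
      (by simp [hc0]) ht
    exact (Prod.ext_iff.1 this).1
  have hmem : ∀ t : ℝ, t ∈ Ioo (-((⌊|t|⌋₊ + 1 : ℕ) : ℝ)) ((⌊|t|⌋₊ + 1 : ℕ) : ℝ) := fun t => by
    have := Nat.lt_floor_add_one |t|
    push_cast
    exact abs_lt.1 this
  have heq : ∀ (m : ℕ) (t : ℝ), t ∈ Ioo (-(m : ℝ)) m → c (⌊|t|⌋₊ + 1) t = c m t := fun m t ht => by
    rcases le_total m (⌊|t|⌋₊ + 1) with h | h
    · exact (huniq h t ht).symm
    · exact huniq h t (hmem t)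
  refine ⟨fun t => c (⌊|t|⌋₊ + 1) t, hc0 _, fun t => ?_⟩
  have h1 := hc _ t (hmem t)
  refine h1.congr_of_eventuallyEq ?_
  filter_upwards [isOpen_Ioo.mem_nhds (hmem t)] with s hs using heq _ s hs

/-- A smooth compactly supported time-dependent vector field has a global smooth flow with smooth
inverse. -/
theorem exists_flow {X : F → ℝ → F} (hX : ContDiff ℝ ∞ fun p : F × ℝ => X p.1 p.2)
    {K : Set F} (hK : IsCompact K) (h0 : ∀ t, ∀ z ∉ K, X z t = 0) :
    ∃ f : ℝ → Equiv.Perm F, f 0 = 1 ∧ (∀ z t, HasDerivAt (fun s => f s z) (X (f t z) t) t) ∧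
      ContDiff ℝ ∞ (fun p : F × ℝ => f p.2 p.1) ∧
      ContDiff ℝ ∞ (fun p : F × ℝ => (f p.2).symm p.1) := by
  have hex : ∀ p : F × ℝ, ∃ c : ℝ → F, c 0 = p.1 ∧ ∀ t, HasDerivAt c (X (c t) (p.2 + t)) t :=
    fun p => exists_solution (X := fun z t => X z (p.2 + t))
      (hX.comp (by fun_prop : ContDiff ℝ ∞ fun q : F × ℝ => (q.1, p.2 + q.2))) hK
      (fun t z hz => h0 _ z hz) p.1
  choose c hc0 hc using hex
  -- Starting the suspended flow at any initial time makes the inverse of the time-t map explicit: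
  -- run for time -t from (w, t).
  let Φ : F × ℝ → ℝ → F × ℝ := fun p t => (c p t, p.2 + t)
  have hv := contDiff_suspension hX
  have hv1 : ContDiff ℝ 1 (suspension X) := hv.of_le (by exact_mod_cast le_top)
  have hΦ0 : ∀ p, Φ p 0 = p := fun p => by simp [Φ, hc0]
  have hΦ : ∀ p t, HasDerivAt (Φ p) (suspension X (Φ p t)) t := fun p t =>
    (hc p t).prodMk ((hasDerivAt_id t).const_add p.2)
  have hsm := contDiff_flow hv hΦ0 hΦ
  have hadd := flow_add hv1 hΦ0 hΦ
  refine ⟨fun t => ⟨fun z => (Φ (z, 0) t).1, fun w => (Φ (w, t) (-t)).1, fun z => ?_, fun w => ?_⟩,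
    ?_, fun z t => ?_, ?_, ?_⟩
  · have h1 : ((Φ (z, 0) t).1, t) = Φ (z, 0) t := by simp [Φ]
    show (Φ ((Φ (z, 0) t).1, t) (-t)).1 = z
    rw [h1, ← hadd, add_neg_cancel, hΦ0]
  · have h1 : ((Φ (w, t) (-t)).1, (0 : ℝ)) = Φ (w, t) (-t) := by simp [Φ]
    show (Φ ((Φ (w, t) (-t)).1, 0) t).1 = w
    rw [h1, ← hadd, neg_add_cancel, hΦ0]
  · ext1 z
    simp [Φ, hc0]
  · simpa [Φ] using hc (z, 0) t
  · exact contDiff_fst.comp (hsm.comp (by fun_prop : ContDiff ℝ ∞ fun p : F × ℝ => ((p.1, (0:ℝ)), p.2)))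
  · exact contDiff_fst.comp (hsm.comp (by fun_prop : ContDiff ℝ ∞ fun p : F × ℝ => (p, -p.2)))

end TimeDependent

/-! ### The symplectic form and Hamiltonian vector fields -/

variable {n : ℕ}

/-- The standard symplectic form as a continuous bilinear map. -/
def omegaL (n : ℕ) : E n →L[ℝ] E n →L[ℝ] ℝ :=
  ∑ i : Fin n,
    ((EuclideanSpace.proj (𝕜 := ℝ) (Sum.inl i : Fin n ⊕ Fin n)).smulRight
        (EuclideanSpace.proj (𝕜 := ℝ) (Sum.inr i : Fin n ⊕ Fin n)) -
      (EuclideanSpace.proj (𝕜 := ℝ) (Sum.inr i : Fin n ⊕ Fin n)).smulRight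
        (EuclideanSpace.proj (𝕜 := ℝ) (Sum.inl i : Fin n ⊕ Fin n)))

@[simp] theorem omegaL_apply (u v : E n) : omegaL n u v = omega0 u v := by
  simp [omegaL, omega0]

theorem omega0_antisymm (u v : E n) : omega0 u v = -omega0 v u := by
  simp only [omega0, ← Finset.sum_neg_distrib]
  exact Finset.sum_congr rfl fun i _ => by ring

theorem two_le_infty : minSmoothness ℝ 2 ≤ (∞ : WithTop ℕ∞) := by
  rw [minSmoothness_of_isRCLikeNormedField]
  exact WithTop.coe_le_coe.2 (le_top : (2 : ℕ∞) ≤ ⊤)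

theorem hasDerivAt_omega0 {a b : ℝ → E n} {a' b' : E n} {t : ℝ} (ha : HasDerivAt a a' t)
    (hb : HasDerivAt b b' t) :
    HasDerivAt (fun s => omega0 (a s) (b s)) (omega0 (a t) b' + omega0 a' (b t)) t := by
  have := (omegaL n).hasDerivAt_of_bilinear (fun _ => ha) (fun _ => hb)
  simpa using this

theorem omega0_single_inl (u : E n) (i : Fin n) :
    omega0 u (EuclideanSpace.single (Sum.inl i) 1) = -u (Sum.inr i) := by
  simp [omega0]

theorem omega0_single_inr (u : E n) (i : Fin n) :
    omega0 u (EuclideanSpace.single (Sum.inr i) 1) = u (Sum.inl i) := by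
  simp [omega0]

theorem omega0_nondegenerate {u v : E n} (h : ∀ w, omega0 u w = omega0 v w) : u = v := by
  ext a
  rcases a with i | i
  · simpa [omega0_single_inr] using h (EuclideanSpace.single (Sum.inr i) 1)
  · simpa [omega0_single_inl] using h (EuclideanSpace.single (Sum.inl i) 1)

/-- The Hamiltonian vector field is characterised by `i_X ω₀ = -dG`. -/
theorem eq_hamVF {G : E n → ℝ} {z u : E n} (h : ∀ w, omega0 u w = -fderiv ℝ G z w) :
    u = hamVF G z :=
  omega0_nondegenerate fun w => by rw [h, omega0_hamVF]

/-- The linear map from covectors to vectors that is given by the symplectic form. -/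
def sharp (n : ℕ) : (E n →L[ℝ] ℝ) →L[ℝ] E n :=
  LinearMap.toContinuousLinearMap
    { toFun := fun L => WithLp.toLp 2 (Sum.elim
        (fun i => -(L (EuclideanSpace.single (Sum.inr i) 1)))
        (fun i => L (EuclideanSpace.single (Sum.inl i) 1)))
      map_add' := fun L M => by
        ext a
        rcases a with i | i <;> simp
        ring
      map_smul' := fun c L => by
        ext a
        rcases a with i | i <;> simp }

theorem hamVF_eq_sharp (G : E n → ℝ) (z : E n) : hamVF G z = sharp n (fderiv ℝ G z) := rfl

theorem hamVF_congr {G G' : E n → ℝ} {z : E n} (h : G =ᶠ[𝓝 z] G') : hamVF G z = hamVF G' z := by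
  rw [hamVF_eq_sharp, hamVF_eq_sharp, h.fderiv_eq]

theorem hamVF_zero_of_eventually {G : E n → ℝ} {z : E n} (h : ∀ᶠ y in 𝓝 z, G y = 0) :
    hamVF G z = 0 := by
  have : G =ᶠ[𝓝 z] fun _ => 0 := h
  rw [hamVF_eq_sharp, this.fderiv_eq]
  simp

theorem hamVF_const_mul {G : E n → ℝ} {z : E n} (hG : DifferentiableAt ℝ G z) (c : ℝ) :
    hamVF (fun y => c * G y) z = c • hamVF G z := by
  rw [hamVF_eq_sharp, hamVF_eq_sharp, fderiv_const_mul hG, map_smul]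

theorem contDiff_hamVF {H : E n → ℝ → ℝ} (hH : ContDiff ℝ ∞ fun p : E n × ℝ => H p.1 p.2) :
    ContDiff ℝ ∞ fun p : E n × ℝ => hamVF (fun y => H y p.2) p.1 := by
  have : (fun p : E n × ℝ => hamVF (fun y => H y p.2) p.1) = fun p : E n × ℝ =>
      sharp n ((fderiv ℝ (fun p : E n × ℝ => H p.1 p.2) p).comp (.inl ℝ (E n) ℝ)) := by
    ext1 p
    rw [hamVF_eq_sharp, fderiv_slice hH]
  rw [this]
  exact (sharp n).contDiff.comp (((contDiff_infty_iff_fderiv.1 hH).2).clm_comp contDiff_const)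

/-! ### Hamiltonian isotopies are symplectic -/

/-- A smooth Hamiltonian isotopy: a time-dependent Hamiltonian function on `ℝ²ⁿ × ℝ` whose supports
lie in one compact set, together with its flow. -/
structure HamIsotopy (n : ℕ) where
  H : E n → ℝ → ℝ
  flow : ℝ → Equiv.Perm (E n)
  smooth_H : ContDiff ℝ ∞ fun p : E n × ℝ => H p.1 p.2
  compact_H : ∃ K : Set (E n), IsCompact K ∧ ∀ t, ∀ z ∉ K, H z t = 0
  smooth_flow : ContDiff ℝ ∞ fun p : E n × ℝ => flow p.2 p.1
  smooth_symm : ContDiff ℝ ∞ fun p : E n × ℝ => (flow p.2).symm p.1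
  flow_zero : flow 0 = 1
  hasDerivAt : ∀ z t, HasDerivAt (fun s => flow s z) (hamVF (fun y => H y t) (flow t z)) t

/-- Every smooth compactly supported Hamiltonian function generates a Hamiltonian isotopy. -/
theorem exists_hamIsotopy {H : E n → ℝ → ℝ} (hH : ContDiff ℝ ∞ fun p : E n × ℝ => H p.1 p.2)
    {K : Set (E n)} (hK : IsCompact K) (h0 : ∀ t, ∀ z ∉ K, H z t = 0) :
    ∃ J : HamIsotopy n, J.H = H := by
  obtain ⟨f, h1, h2, h3, h4⟩ := exists_flow (X := fun z t => hamVF (fun y => H y t) z)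
    (contDiff_hamVF hH) hK (fun t z hz => hamVF_zero_of_eventually (by
      filter_upwards [hK.isClosed.isOpen_compl.mem_nhds hz] with y hy using h0 t y hy))
  exact ⟨⟨H, f, hH, ⟨K, hK, h0⟩, h3, h4, h1, h2⟩, rfl⟩

namespace HamIsotopy

variable (J : HamIsotopy n)

theorem smooth_H_slice (t : ℝ) : ContDiff ℝ ∞ fun z => J.H z t :=
  J.smooth_H.comp (contDiff_prodMk_left t)

theorem differentiable_H (t : ℝ) : Differentiable ℝ fun z => J.H z t :=
  (J.smooth_H_slice t).differentiable (by simp)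

theorem smooth_flow_slice (t : ℝ) : ContDiff ℝ ∞ fun z => J.flow t z :=
  J.smooth_flow.comp (contDiff_prodMk_left t)

theorem smooth_symm_slice (t : ℝ) : ContDiff ℝ ∞ fun z => (J.flow t).symm z :=
  J.smooth_symm.comp (contDiff_prodMk_left t)

/-- Curves on `[0, 1]` that follow the Hamiltonian vector field are orbits of the flow. -/
theorem flow_eq_of_hasDerivWithinAt {c : ℝ → E n}
    (hc : ∀ t ∈ Icc (0 : ℝ) 1,
      HasDerivWithinAt c (hamVF (fun y => J.H y t) (c t)) (Icc 0 1) t) :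
    ∀ t ∈ Icc (0 : ℝ) 1, J.flow t (c 0) = c t := by
  intro t ht
  have hv : ContDiff ℝ 1 (suspension fun (z : E n) t => hamVF (fun y => J.H y t) z) :=
    (contDiff_suspension (contDiff_hamVF J.smooth_H)).of_le (by exact_mod_cast le_top)
  have := eqOn_of_hasDerivWithinAt hv (c := fun t => (J.flow t (c 0), t)) (d := fun t => (c t, t))
    (fun t _ => ((J.hasDerivAt (c 0) t).prodMk (hasDerivAt_id t)).hasDerivWithinAt)
    (fun t ht => (hc t ht).prodMk (hasDerivAt_id t).hasDerivWithinAt)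
    (by simp [J.flow_zero]) ht
  exact (Prod.ext_iff.1 this).1

/-- Curves that follow the Hamiltonian vector field are orbits of the flow. -/
theorem flow_eq_of_hasDerivAt {c : ℝ → E n}
    (hc : ∀ t, HasDerivAt c (hamVF (fun y => J.H y t) (c t)) t) (t : ℝ) :
    J.flow t (c 0) = c t := by
  have hv : ContDiff ℝ 1 (suspension fun (z : E n) t => hamVF (fun y => J.H y t) z) :=
    (contDiff_suspension (contDiff_hamVF J.smooth_H)).of_le (by exact_mod_cast le_top)
  have := eq_of_hasDerivAt hv (c := fun t => (J.flow t (c 0), t)) (d := fun t => (c t, t))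
    (fun t => (J.hasDerivAt (c 0) t).prodMk (hasDerivAt_id t))
    (fun t => (hc t).prodMk (hasDerivAt_id t))
    (by simp [J.flow_zero]) t
  exact (Prod.ext_iff.1 this).1

/-- The derivative of the flow in the space directions. -/
def D (t : ℝ) (z : E n) : E n →L[ℝ] E n := fderiv ℝ (fun y => J.flow t y) z

theorem hasFDerivAt_flow (t : ℝ) (z : E n) : HasFDerivAt (fun y => J.flow t y) (J.D t z) z :=
  ((J.smooth_flow_slice t).differentiable (by simp) z).hasFDerivAt

/-- The variational equation. -/
theorem hasDerivAt_D (z u : E n) (t : ℝ) :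
    HasDerivAt (fun s => J.D s z u)
      (fderiv ℝ (fun y => hamVF (fun x => J.H x t) y) (J.flow t z) (J.D t z u)) t := by
  let Φ : E n × ℝ → E n := fun p => J.flow p.2 p.1
  have hΦ : ContDiff ℝ ∞ Φ := J.smooth_flow
  have hD : ∀ s y, J.D s y = (fderiv ℝ Φ (y, s)).comp (.inl ℝ (E n) ℝ) := fun s y =>
    fderiv_slice (X := fun z t => J.flow t z) J.smooth_flow y s
  have hΦ' : ContDiff ℝ ∞ (fderiv ℝ Φ) := (contDiff_infty_iff_fderiv.1 hΦ).2
  have hsec : HasFDerivAt (fderiv ℝ Φ) (fderiv ℝ (fderiv ℝ Φ) (z, t)) (z, t) :=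
    (hΦ'.differentiable (by simp) (z, t)).hasFDerivAt
  have ht : ∀ y, fderiv ℝ Φ (y, t) (0, 1) = hamVF (fun x => J.H x t) (J.flow t y) := fun y => by
    have h1 := ((hΦ.differentiable (by simp)) (y, t)).hasFDerivAt.comp_hasDerivAt t
      ((hasDerivAt_const t y).prodMk (hasDerivAt_id t))
    exact h1.unique (J.hasDerivAt y t)
  have h1 : HasDerivAt (fun s => fderiv ℝ Φ (z, s) (u, 0))
      (fderiv ℝ (fderiv ℝ Φ) (z, t) (0, 1) (u, 0)) t := by
    have := (hsec.comp_hasDerivAt t ((hasDerivAt_const t z).prodMk (hasDerivAt_id t))).clm_apply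
      (hasDerivAt_const t ((u, 0) : E n × ℝ))
    simpa using this
  have h2 : HasFDerivAt (fun y => fderiv ℝ Φ (y, t) (0, 1))
      (((fderiv ℝ (fderiv ℝ Φ) (z, t)).comp (.inl ℝ (E n) ℝ)).flip (0, 1)) z := by
    have hin : HasFDerivAt (fun y : E n => (y, t)) (.inl ℝ (E n) ℝ) z :=
      hasFDerivAt_prodMk_left z t
    have := (HasFDerivAt.comp (g := fderiv ℝ Φ) z hsec hin).clm_apply
      (hasFDerivAt_const ((0, 1) : E n × ℝ) z)
    simpa using this
  have h3 : HasFDerivAt (fun y => hamVF (fun x => J.H x t) (J.flow t y))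
      ((fderiv ℝ (fun y => hamVF (fun x => J.H x t) y) (J.flow t z)).comp (J.D t z)) z := by
    have hX : ContDiff ℝ ∞ fun y => hamVF (fun x => J.H x t) y :=
      (contDiff_hamVF J.smooth_H).comp (contDiff_prodMk_left t)
    exact (hX.differentiable (by simp) _).hasFDerivAt.comp z (J.hasFDerivAt_flow t z)
  simp only [ht] at h2
  have h4 := DFunLike.congr_fun (h2.unique h3) u
  -- Space and time derivatives commute, so the time derivative of the differential is the space
  -- derivative of the velocity.
  have hsymm : fderiv ℝ (fderiv ℝ Φ) (z, t) (0, 1) (u, 0)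
      = fderiv ℝ (fderiv ℝ Φ) (z, t) (u, 0) (0, 1) :=
    (hΦ.contDiffAt.isSymmSndFDerivAt two_le_infty).eq _ _
  simp only [ContinuousLinearMap.flip_apply, ContinuousLinearMap.comp_apply,
    ContinuousLinearMap.inl_apply] at h4
  rw [hsymm, h4] at h1
  simpa [hD] using h1

/-- Differentiate ω₀(X_G, v) = -dG(v). The symmetry of the Hessian then makes X_G infinitesimally
symplectic. -/
theorem omega0_fderiv_hamVF {G : E n → ℝ} (hG : ContDiff ℝ ∞ G) (z u v : E n) :
    omega0 (fderiv ℝ (hamVF G) z u) v = -fderiv ℝ (fderiv ℝ G) z u v := by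
  have hG' : ContDiff ℝ ∞ (fderiv ℝ G) := (contDiff_infty_iff_fderiv.1 hG).2
  have hX : HasFDerivAt (hamVF G) ((sharp n).comp (fderiv ℝ (fderiv ℝ G) z)) z :=
    (sharp n).hasFDerivAt.comp z (hG'.differentiable (by simp) z).hasFDerivAt
  have h1 := (((omegaL n).flip v).hasFDerivAt (x := hamVF G z)).comp z
    (hX.differentiableAt.hasFDerivAt)
  have h2 : HasFDerivAt (fun y => -fderiv ℝ G y v) (-((fderiv ℝ (fderiv ℝ G) z).flip v)) z := by
    have := ((hG'.differentiable (by simp) z).hasFDerivAt.clm_apply (hasFDerivAt_const v z)).fun_neg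
    simpa using this
  have h3 : (⇑((omegaL n).flip v) ∘ hamVF G) = fun y => -fderiv ℝ G y v := by
    ext y
    simp [omega0_hamVF]
  rw [h3] at h1
  simpa using DFunLike.congr_fun (h1.unique h2) u

/-- The maps of a Hamiltonian flow are symplectic. -/
theorem omega0_D (t : ℝ) (z u v : E n) : omega0 (J.D t z u) (J.D t z v) = omega0 u v := by
  have hd : ∀ t, HasDerivAt (fun s => omega0 (J.D s z u) (J.D s z v)) 0 t := fun t => by
    have h := hasDerivAt_omega0 (J.hasDerivAt_D z u t) (J.hasDerivAt_D z v t)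
    convert h using 1
    rw [omega0_antisymm (J.D t z u), omega0_fderiv_hamVF (J.smooth_H_slice t),
      omega0_fderiv_hamVF (J.smooth_H_slice t),
      ((J.smooth_H_slice t).contDiffAt.isSymmSndFDerivAt two_le_infty).eq (J.D t z u)]
    ring
  have h0 : J.D 0 z = ContinuousLinearMap.id ℝ _ := by
    have : (fun y => J.flow 0 y) = id := by rw [J.flow_zero]; rfl
    rw [D, this]
    exact fderiv_id
  have := is_const_of_deriv_eq_zero (fun t => (hd t).differentiableAt) (fun t => (hd t).deriv) t 0
  simpa [h0] using this

end HamIsotopy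

/-! ### Operations on Hamiltonian isotopies -/

/-- The push-forward of a Hamiltonian vector field by a conformally symplectic map. -/
theorem map_hamVF {P : Equiv.Perm (E n)} (hP : Differentiable ℝ P) (hP' : Differentiable ℝ P.symm)
    {c : ℝ} {z : E n}
    (hc : ∀ u v, omega0 (fderiv ℝ P z u) (fderiv ℝ P z v) = c * omega0 u v)
    {G : E n → ℝ} (hG : DifferentiableAt ℝ G z) :
    fderiv ℝ P z (hamVF G z) = hamVF (fun w => c * G (P.symm w)) (P z) := by
  refine eq_hamVF fun v => ?_
  have hz : P.symm (P z) = z := P.symm_apply_apply z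
  have hinv : (fderiv ℝ P z).comp (fderiv ℝ P.symm (P z)) = ContinuousLinearMap.id ℝ _ := by
    have h1 : HasFDerivAt (P ∘ P.symm) ((fderiv ℝ P z).comp (fderiv ℝ P.symm (P z))) (P z) := by
      have h := (hP (P.symm (P z))).hasFDerivAt
      rw [hz] at h
      have h' := (hP (P.symm (P z))).hasFDerivAt.comp (P z) (hP' (P z)).hasFDerivAt
      rwa [hz] at h'
    have h2 : P ∘ P.symm = id := by ext1 w; simp
    rw [h2] at h1
    exact h1.unique (hasFDerivAt_id _)
  have hv : fderiv ℝ P z (fderiv ℝ P.symm (P z) v) = v := DFunLike.congr_fun hinv v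
  have hG' : HasFDerivAt (fun w => c * G (P.symm w))
      (c • (fderiv ℝ G z).comp (fderiv ℝ P.symm (P z))) (P z) := by
    have h : HasFDerivAt G (fderiv ℝ G z) (P.symm (P z)) := by rw [hz]; exact hG.hasFDerivAt
    exact (h.comp (P z) (hP' (P z)).hasFDerivAt).const_mul c
  rw [hG'.fderiv]
  conv_lhs => rw [← hv]
  rw [hc, omega0_hamVF]
  simp

namespace HamIsotopy

/-- As `S` is closed, the Hamiltonian vanishes near z, and the constant curve is an orbit. -/
theorem flow_eq_self (J : HamIsotopy n) {S : Set (E n)} (hS : IsClosed S)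
    (h : ∀ t, ∀ z ∉ S, J.H z t = 0) (t : ℝ) {z : E n} (hz : z ∉ S) : J.flow t z = z :=
  J.flow_eq_of_hasDerivAt (c := fun _ => z) (fun s => by
    rw [hamVF_zero_of_eventually]
    · exact hasDerivAt_const _ _
    · filter_upwards [hS.isOpen_compl.mem_nhds hz] with y hy using h s y hy) t

/-- The isotopy `f_t⁻¹ h_t`. -/
def invMul (J L : HamIsotopy n) : HamIsotopy n where
  H z t := L.H (J.flow t z) t - J.H (J.flow t z) t
  flow t := (J.flow t)⁻¹ * L.flow t
  smooth_H := by
    have h : ContDiff ℝ ∞ fun p : E n × ℝ => (J.flow p.2 p.1, p.2) :=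
      J.smooth_flow.prodMk contDiff_snd
    exact (L.smooth_H.comp h).sub (J.smooth_H.comp h)
  compact_H := by
    obtain ⟨K, hK, hK0⟩ := J.compact_H
    obtain ⟨M, hM, hM0⟩ := L.compact_H
    refine ⟨K ∪ M, hK.union hM, fun t z hz => ?_⟩
    rw [mem_union, not_or] at hz
    rw [J.flow_eq_self hK.isClosed hK0 t hz.1, hK0 t z hz.1, hM0 t z hz.2, sub_zero]
  smooth_flow := J.smooth_symm.comp
    (L.smooth_flow.prodMk contDiff_snd : ContDiff ℝ ∞ fun p : E n × ℝ => (L.flow p.2 p.1, p.2))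
  smooth_symm := L.smooth_symm.comp
    (J.smooth_flow.prodMk contDiff_snd : ContDiff ℝ ∞ fun p : E n × ℝ => (J.flow p.2 p.1, p.2))
  flow_zero := by simp [J.flow_zero, L.flow_zero]
  hasDerivAt z t := by
    let w : ℝ → E n := fun s => (J.flow s).symm (L.flow s z)
    have hw : DifferentiableAt ℝ w t := by
      have h1 : ContDiff ℝ ∞ fun s : ℝ => (L.flow s z, s) :=
        (L.smooth_flow.comp (contDiff_prodMk_right z)).prodMk contDiff_id
      exact (J.smooth_symm.comp h1).differentiable (by simp) t
    -- Differentiating this identity gives D(J_t) w' = X_L - X_J at L_t z. Since D(J_t) preserves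
    -- ω₀, pairing with D(J_t) v identifies w' as the field of the pulled-back difference.
    have hfw : ∀ s, J.flow s (w s) = L.flow s z := fun s => (J.flow s).apply_symm_apply _
    have hderiv : HasDerivAt (fun s => J.flow s (w s))
        (hamVF (fun y => J.H y t) (J.flow t (w t)) + J.D t (w t) (deriv w t)) t := by
      have h1 : HasFDerivAt (fun p : E n × ℝ => J.flow p.2 p.1)
          (fderiv ℝ (fun p : E n × ℝ => J.flow p.2 p.1) (w t, t)) (w t, t) :=
        (J.smooth_flow.differentiable (by simp) _).hasFDerivAt
      have h2 := h1.comp_hasDerivAt (f := fun s => (w s, s)) t (hw.hasDerivAt.prodMk (hasDerivAt_id t))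
      have h3 := h1.comp_hasDerivAt (f := fun s => (w t, s)) t ((hasDerivAt_const t (w t)).prodMk (hasDerivAt_id t))
      have h4 := h3.unique (J.hasDerivAt (w t) t)
      have h5 : J.D t (w t) (deriv w t)
          = fderiv ℝ (fun p : E n × ℝ => J.flow p.2 p.1) (w t, t) (deriv w t, 0) :=
        DFunLike.congr_fun (fderiv_slice (X := fun z t => J.flow t z) J.smooth_flow (w t) t) _
      rw [h5, ← h4, ← map_add]
      simpa [Function.comp_def] using h2
    simp only [hfw] at hderiv
    have hE := hderiv.unique (L.hasDerivAt z t)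
    have hkey : deriv w t = hamVF (fun y => L.H (J.flow t y) t - J.H (J.flow t y) t) (w t) := by
      refine eq_hamVF fun v => ?_
      have hd : HasFDerivAt (fun y => L.H (J.flow t y) t - J.H (J.flow t y) t)
          ((fderiv ℝ (fun y => L.H y t) (J.flow t (w t))).comp (J.D t (w t)) -
            (fderiv ℝ (fun y => J.H y t) (J.flow t (w t))).comp (J.D t (w t))) (w t) :=
        ((L.differentiable_H t _).hasFDerivAt.comp (w t) (J.hasFDerivAt_flow t (w t))).sub
          ((J.differentiable_H t _).hasFDerivAt.comp (w t) (J.hasFDerivAt_flow t (w t)))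
      have h6 : J.D t (w t) (deriv w t) = hamVF (fun y => L.H y t) (L.flow t z) -
          hamVF (fun y => J.H y t) (L.flow t z) := by
        rw [← hE]; abel
      rw [hd.fderiv, ← J.omega0_D t (w t), h6, ← omegaL_apply, map_sub,
        sub_apply, omegaL_apply, omegaL_apply, omega0_hamVF, omega0_hamVF, hfw]
      simp only [sub_apply, ContinuousLinearMap.comp_apply]
      ring
    have := hw.hasDerivAt
    rw [hkey] at this
    exact this

/-- The constant isotopy. -/
def const (n : ℕ) : HamIsotopy n where
  H _ _ := 0
  flow _ := 1
  smooth_H := contDiff_const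
  compact_H := ⟨∅, isCompact_empty, fun _ _ _ => rfl⟩
  smooth_flow := contDiff_fst
  smooth_symm := contDiff_fst
  flow_zero := rfl
  hasDerivAt z t := by
    rw [hamVF_zero_of_eventually (Eventually.of_forall fun _ => rfl)]
    exact hasDerivAt_const _ _

/-- Conjugation of an isotopy by a conformally symplectic diffeomorphism. -/
def conj (J : HamIsotopy n) (P : Equiv.Perm (E n)) (hP : ContDiff ℝ ∞ P) (hP' : ContDiff ℝ ∞ P.symm)
    (c : ℝ) (hc : ∀ z u v, omega0 (fderiv ℝ P z u) (fderiv ℝ P z v) = c * omega0 u v) :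
    HamIsotopy n where
  H w t := c * J.H (P.symm w) t
  flow t := P * J.flow t * P⁻¹
  smooth_H := contDiff_const.mul (J.smooth_H.comp ((hP'.comp contDiff_fst).prodMk contDiff_snd))
  compact_H := by
    obtain ⟨K, hK, hK0⟩ := J.compact_H
    refine ⟨P '' K, hK.image hP.continuous, fun t z hz => ?_⟩
    rw [hK0 t, mul_zero]
    exact fun h => hz ⟨_, h, P.apply_symm_apply z⟩
  smooth_flow := hP.comp (J.smooth_flow.comp ((hP'.comp contDiff_fst).prodMk contDiff_snd))
  smooth_symm := hP.comp (J.smooth_symm.comp ((hP'.comp contDiff_fst).prodMk contDiff_snd))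
  flow_zero := by simp [J.flow_zero]
  hasDerivAt z t := by
    have hd := hP.differentiable (by simp)
    have h := (hd (J.flow t (P.symm z))).hasFDerivAt.comp_hasDerivAt t
      (J.hasDerivAt (P.symm z) t)
    rw [map_hamVF hd (hP'.differentiable (by simp)) (hc _) (J.differentiable_H t _)] at h
    exact h

/-- Time reparametrization of an isotopy. -/
def reparam (J : HamIsotopy n) (a : ℝ → ℝ) (ha : ContDiff ℝ ∞ a) : HamIsotopy n where
  H z t := deriv a t * J.H z (a t)
  -- Right translation makes the flow start at the identity and does not change its Hamiltonian.
  flow t := J.flow (a t) * (J.flow (a 0))⁻¹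
  smooth_H := ((contDiff_infty_iff_deriv.1 ha).2.comp contDiff_snd).mul
    (J.smooth_H.comp (contDiff_fst.prodMk (ha.comp contDiff_snd)))
  compact_H := by
    obtain ⟨K, hK, hK0⟩ := J.compact_H
    exact ⟨K, hK, fun t z hz => by rw [hK0 _ z hz, mul_zero]⟩
  smooth_flow := J.smooth_flow.comp
    (((J.smooth_symm_slice (a 0)).comp contDiff_fst).prodMk (ha.comp contDiff_snd))
  smooth_symm := (J.smooth_flow_slice (a 0)).comp
    (J.smooth_symm.comp (contDiff_fst.prodMk (ha.comp contDiff_snd)))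
  flow_zero := by simp
  hasDerivAt z t := by
    rw [hamVF_const_mul (J.differentiable_H _ _)]
    exact (J.hasDerivAt ((J.flow (a 0)).symm z) (a t)).scomp t
      ((ha.differentiable (by simp)) t).hasDerivAt

theorem isNormalized (J : HamIsotopy n) (a b : ℝ) : IsNormalized a b J.H := by
  obtain ⟨K, hK, hK0⟩ := J.compact_H
  refine ⟨J.smooth_H.contDiffOn, K, hK, fun t _ => closure_minimal (fun z hz => ?_) hK.isClosed⟩
  by_contra h
  exact hz (hK0 t z h)

theorem flow_one_mem_Ham (J : HamIsotopy n) : J.flow 1 ∈ Ham n :=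
  ⟨J.H, fun t => J.flow t, J.isNormalized 0 1, fun z t _ => (J.hasDerivAt z t).hasDerivWithinAt,
    congrArg (fun P : Equiv.Perm (E n) => (P : E n → E n)) J.flow_zero, rfl⟩

/-- Run the isotopy at the constant speed t. -/
theorem flow_mem_Ham (J : HamIsotopy n) (t : ℝ) : J.flow t ∈ Ham n := by
  have := (J.reparam (fun s => t * s) (by fun_prop)).flow_one_mem_Ham
  simpa [reparam, J.flow_zero] using this

end HamIsotopy

/-! ### The group of Hamiltonian diffeomorphisms -/

/-- Every element of `Ham` is the end point of a Hamiltonian isotopy that is defined for all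
times. -/
theorem exists_hamIsotopy_of_mem_Ham {φ : Equiv.Perm (E n)} (hφ : φ ∈ Ham n) :
    ∃ J : HamIsotopy n, J.flow 1 = φ := by
  obtain ⟨F, f, ⟨hF, K, hK, hFK⟩, hf, hf0, hf1⟩ := hφ
  -- F is controlled only on [0, 1]. A clock with values in [0, 1], constant outside [0, 1], extends
  -- the isotopy to all times without changing its end point.
  let β := Real.smoothTransition
  have hβ : ContDiff ℝ ∞ β := Real.smoothTransition.contDiff
  have hβm : ∀ t, β t ∈ Icc (0 : ℝ) 1 := fun t =>
    ⟨Real.smoothTransition.nonneg t, Real.smoothTransition.le_one t⟩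
  have hsm : ContDiff ℝ ∞ fun p : E n × ℝ => F p.1 (β p.2) :=
    contDiffOn_univ.1 (hF.comp
      (contDiff_fst.prodMk (hβ.comp contDiff_snd) :
        ContDiff ℝ ∞ fun p : E n × ℝ => (p.1, β p.2)).contDiffOn
      fun p _ => ⟨mem_univ _, hβm _⟩)
  obtain ⟨J, hJ⟩ := exists_hamIsotopy (H := fun z t => deriv β t * F z (β t))
    (((contDiff_infty_iff_deriv.1 hβ).2.comp contDiff_snd).mul hsm) hK (fun t z hz => by
      have : F z (β t) = 0 := by
        by_contra h
        exact hz (hFK _ (hβm t) (subset_tsupport _ h))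
      rw [this, mul_zero])
  refine ⟨J, Equiv.ext fun z => ?_⟩
  have h := J.flow_eq_of_hasDerivAt (c := fun t => f (β t) z) (fun t => by
    rw [hJ, hamVF_const_mul]
    · exact (hf z (β t) (hβm t)).scomp_hasDerivAt t
        ((hβ.differentiable (by simp)) t).hasDerivAt hβm
    · exact (hsm.comp (contDiff_prodMk_left t)).differentiable (by simp) _) 1
  simpa [β, hf0, hf1] using h

theorem mem_Ham_iff {φ : Equiv.Perm (E n)} : φ ∈ Ham n ↔ ∃ J : HamIsotopy n, J.flow 1 = φ :=
  ⟨exists_hamIsotopy_of_mem_Ham, fun ⟨J, hJ⟩ => hJ ▸ J.flow_one_mem_Ham⟩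

theorem Ham.inv_mul {φ ψ : Equiv.Perm (E n)} (hφ : φ ∈ Ham n) (hψ : ψ ∈ Ham n) :
    φ⁻¹ * ψ ∈ Ham n := by
  obtain ⟨J, rfl⟩ := mem_Ham_iff.1 hφ
  obtain ⟨L, rfl⟩ := mem_Ham_iff.1 hψ
  have h := (J.invMul L).flow_one_mem_Ham
  exact h

theorem Ham.one : (1 : Equiv.Perm (E n)) ∈ Ham n := (HamIsotopy.const n).flow_one_mem_Ham

theorem Ham.inv {φ : Equiv.Perm (E n)} (hφ : φ ∈ Ham n) : φ⁻¹ ∈ Ham n := by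
  simpa using Ham.inv_mul hφ Ham.one

theorem Ham.mul {φ ψ : Equiv.Perm (E n)} (hφ : φ ∈ Ham n) (hψ : ψ ∈ Ham n) : φ * ψ ∈ Ham n := by
  simpa using Ham.inv_mul (Ham.inv hφ) hψ

theorem Ham.contDiff {φ : Equiv.Perm (E n)} (hφ : φ ∈ Ham n) : ContDiff ℝ ∞ φ := by
  obtain ⟨J, rfl⟩ := mem_Ham_iff.1 hφ
  exact J.smooth_flow_slice 1

/-! ### Paths -/

/-- Right translation of a path. -/
def HamPath.mulRight {φ ψ : Equiv.Perm (E n)} (γ : HamPath φ ψ) {χ : Equiv.Perm (E n)}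
    (hχ : χ ∈ Ham n) : HamPath (φ * χ) (ψ * χ) where
  N := γ.N
  time := γ.time
  time_strictMono := γ.time_strictMono
  time_zero := γ.time_zero
  time_last := γ.time_last
  path t := γ.path t * χ
  path_mem t ht := Ham.mul (γ.path_mem t ht) hχ
  path_zero := by rw [γ.path_zero]
  path_one := by rw [γ.path_one]
  path_smooth l := (γ.path_smooth l).comp
    (((Ham.contDiff hχ).comp contDiff_fst).prodMk contDiff_snd :
      ContDiff ℝ ∞ fun p : E n × ℝ => (χ p.1, p.2)).contDiffOn fun _ hp => ⟨mem_univ _, hp.2⟩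
  F := γ.F
  F_normalized := γ.F_normalized
  F_generates l z := γ.F_generates l (χ z)

/-- A right translate of a path has the same generating Hamiltonians, hence the same length. -/
theorem dStar_mulRight_le (k : ℕ) (φ ψ : Equiv.Perm (E n)) {χ : Equiv.Perm (E n)}
    (hχ : χ ∈ Ham n) : dStar k (φ * χ) (ψ * χ) ≤ dStar k φ ψ :=
  le_iInf fun γ => iInf_le (fun γ : HamPath (φ * χ) (ψ * χ) => γ.lengthStar k) (γ.mulRight hχ)

/-- The quasimetric is right-invariant. -/
theorem dStar_mulRight (k : ℕ) (φ ψ : Equiv.Perm (E n)) {χ : Equiv.Perm (E n)}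
    (hχ : χ ∈ Ham n) : dStar k (φ * χ) (ψ * χ) = dStar k φ ψ := by
  refine le_antisymm (dStar_mulRight_le k φ ψ hχ) ?_
  simpa using dStar_mulRight_le k (φ * χ) (ψ * χ) (Ham.inv hχ)

theorem iteratedDeriv_comp_affine {f : ℝ → ℝ} (hf : ContDiff ℝ ∞ f) (a b : ℝ) (i : ℕ) :
    ∀ c t : ℝ, iteratedDeriv i (fun t => c * f (a * t + b)) t
      = c * a ^ i * iteratedDeriv i f (a * t + b) := by
  induction i generalizing f with
  | zero => intro c t; simp
  | succ i ih =>
    intro c t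
    have h1 : deriv (fun t => c * f (a * t + b)) = fun t => (c * a) * deriv f (a * t + b) := by
      ext1 t
      have h2 : HasDerivAt (fun t => a * t + b) a t := by
        simpa using ((hasDerivAt_id t).const_mul a).add_const b
      have h3 := (((hf.differentiable (by simp)) (a * t + b)).hasDerivAt.comp t h2).const_mul c
      exact h3.deriv.trans (by ring)
    rw [iteratedDeriv_succ', iteratedDeriv_succ', h1, ih (contDiff_infty_iff_deriv.1 hf).2]
    ring

/-! ### Concatenation and its coarse length -/

namespace HamIsotopy

theorem smooth_H_time (J : HamIsotopy n) (z : E n) : ContDiff ℝ ∞ (J.H z) :=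
  J.smooth_H.comp (contDiff_prodMk_right z)

/-- The end points of the pieces of a concatenation. -/
def partialProduct (ι : ℕ → HamIsotopy n) (φ : Equiv.Perm (E n)) : ℕ → Equiv.Perm (E n)
  | 0 => φ
  | l + 1 => (ι l).flow 1 * partialProduct ι φ l

theorem partialProduct_mem (ι : ℕ → HamIsotopy n) {φ : Equiv.Perm (E n)} (hφ : φ ∈ Ham n) (l : ℕ) :
    partialProduct ι φ l ∈ Ham n := by
  induction l with
  | zero => exact hφ
  | succ l ih => exact Ham.mul ((ι l).flow_one_mem_Ham) ih

/-- The concatenation of isotopies, where every piece takes the time `1 / N`. -/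
def concatMap (ι : ℕ → HamIsotopy n) (φ : Equiv.Perm (E n)) (N : ℕ) (t : ℝ) : Equiv.Perm (E n) :=
  (ι ⌊N * t⌋₊).flow (N * t - ⌊N * t⌋₊) * partialProduct ι φ ⌊N * t⌋₊

theorem mem_Icc_div_iff {N : ℕ} (hN : 0 < N) {l : ℕ} {t : ℝ} :
    t ∈ Icc ((l : ℝ) / N) ((l + 1 : ℕ) / N) ↔ (l : ℝ) ≤ N * t ∧ N * t ≤ l + 1 := by
  have : (0 : ℝ) < N := by exact_mod_cast hN
  rw [mem_Icc, div_le_iff₀ this, le_div_iff₀ this]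
  push_cast
  rw [mul_comm t]

theorem concatMap_eq (ι : ℕ → HamIsotopy n) (φ : Equiv.Perm (E n)) {N : ℕ} (hN : 0 < N) {l : ℕ}
    {t : ℝ} (ht : t ∈ Icc ((l : ℝ) / N) ((l + 1 : ℕ) / N)) :
    concatMap ι φ N t = (ι l).flow (N * t - l) * partialProduct ι φ l := by
  obtain ⟨h1, h2⟩ := (mem_Icc_div_iff hN).1 ht
  rcases h2.lt_or_eq with h | h
  · have : ⌊N * t⌋₊ = l := by
      rw [Nat.floor_eq_iff (le_trans (by positivity) h1)]
      exact ⟨h1, h⟩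
    rw [concatMap, this]
  -- At the right end point the floor already selects the next piece, which is the identity at its
  -- time 0.
  · have : ⌊N * t⌋₊ = l + 1 := by
      rw [h]
      exact_mod_cast Nat.floor_natCast (l + 1)
    rw [concatMap, this, h]
    push_cast
    rw [sub_self, (ι (l + 1)).flow_zero, one_mul, add_sub_cancel_left]
    rfl

/-- The path that runs through finitely many isotopies one after the other. -/
def concat (ι : ℕ → HamIsotopy n) {φ : Equiv.Perm (E n)} (hφ : φ ∈ Ham n) {N : ℕ} (hN : 0 < N) :
    HamPath φ (partialProduct ι φ N) where
  N := N
  time l := (l : ℕ) / (N : ℝ)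
  time_strictMono l m hlm := by
    have : (0 : ℝ) < N := by exact_mod_cast hN
    have h : ((l : ℕ) : ℝ) < (m : ℕ) := by exact_mod_cast hlm
    exact div_lt_div_of_pos_right h this
  time_zero := by simp
  time_last := by
    have : (N : ℝ) ≠ 0 := by exact_mod_cast hN.ne'
    simp [this]
  path := concatMap ι φ N
  path_mem t _ := Ham.mul ((ι _).flow_mem_Ham _) (partialProduct_mem ι hφ _)
  path_zero := by simp [concatMap, (ι 0).flow_zero, partialProduct]
  path_one := by simp [concatMap, (ι N).flow_zero]
  path_smooth l := by
    have h : ContDiff ℝ ∞ fun p : E n × ℝ =>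
        (ι l).flow (N * p.2 - (l : ℕ)) (partialProduct ι φ l p.1) :=
      (ι l).smooth_flow.comp (((Ham.contDiff (partialProduct_mem ι hφ l)).comp contDiff_fst).prodMk
        (by fun_prop : ContDiff ℝ ∞ fun p : E n × ℝ => N * p.2 - ((l : ℕ) : ℝ)))
    refine h.contDiffOn.congr fun p hp => ?_
    rw [concatMap_eq ι φ hN hp.2]
    rfl
  -- The speed N multiplies the i-th time derivative of the Hamiltonian by N^(i+1).
  F l z t := N * (ι l).H z (N * t + -(l : ℕ))
  F_normalized l := by
    have := ((ι l).reparam (fun t => N * t + -((l : ℕ) : ℝ)) (by fun_prop)).isNormalized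
      ((l.castSucc : ℕ) / (N : ℝ)) ((l.succ : ℕ) / (N : ℝ))
    have hd : ∀ t : ℝ, deriv (fun t : ℝ => N * t + -((l : ℕ) : ℝ)) t = N := fun t => by
      simp
    simpa only [reparam, hd] using this
  F_generates l z t ht := by
    have hd : HasDerivAt (fun t : ℝ => N * t - ((l : ℕ) : ℝ)) N t := by
      simpa using ((hasDerivAt_id t).const_mul (N : ℝ)).sub_const ((l : ℕ) : ℝ)
    have h := ((ι l).hasDerivAt (partialProduct ι φ l z) (N * t - (l : ℕ))).scomp t hd
    rw [← hamVF_const_mul ((ι l).differentiable_H _ _)] at h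
    have he : concatMap ι φ N t z
        = (ι l).flow (N * t - (l : ℕ)) (partialProduct ι φ l z) := by
      rw [concatMap_eq ι φ hN ht]; rfl
    simp only [he]
    refine h.hasDerivWithinAt.congr (fun s hs => ?_) ?_
    · simp only [concatMap_eq ι φ hN hs, Function.comp_apply]
      rfl
    · simp only [concatMap_eq ι φ hN ht, Function.comp_apply]
      rfl

/-- The oscillations of the time derivatives of the Hamiltonian functions up to the order `k` are
bounded by `c` (order `0`) and by `η` (higher orders) on `[0, 1]`. -/
def OscBound (J : HamIsotopy n) (k : ℕ) (c η : ℝ) : Prop :=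
  ∀ t ∈ Icc (0 : ℝ) 1, osc (fun z => J.H z t) ≤ c ∧
    ∀ i ∈ Finset.Icc 1 k, osc (fun z => iteratedDeriv i (J.H z) t) ≤ η

theorem osc_le {G : E n → ℝ} {m M : ℝ} (h : ∀ z, G z ∈ Icc m M) : osc G ≤ M - m :=
  sub_le_sub (ciSup_le fun z => (h z).2) (le_ciInf fun z => (h z).1)

theorem osc_const_mul {G : E n → ℝ} {c : ℝ} (hc : 0 ≤ c) : osc (fun z => c * G z) = c * osc G := by
  rw [osc, osc, ← Real.mul_iSup_of_nonneg hc, ← Real.mul_iInf_of_nonneg hc, mul_sub]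

/-- The coarse length takes the maximum over the pieces, so the number of pieces enters only through
the speed: a factor N in order 0, and at most N^(k+1) in each of the k higher orders. -/
theorem lengthStar_concat_le (ι : ℕ → HamIsotopy n) {φ : Equiv.Perm (E n)} (hφ : φ ∈ Ham n) {N : ℕ}
    (hN : 0 < N) (k : ℕ) {c η : ℝ} (hc : 0 ≤ c) (hη : 0 ≤ η)
    (h : ∀ l < N, (ι l).OscBound k c η) :
    (concat ι hφ hN).lengthStar k ≤ ENNReal.ofReal (N * c + k * (N ^ (k + 1) * η)) := by
  have hN1 : (1 : ℝ) ≤ N := by exact_mod_cast hN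
  have hterm : ∀ i : ℕ, ∀ l : Fin N, ∀ t ∈ Icc (((l.castSucc : ℕ) : ℝ) / N) ((l.succ : ℕ) / N),
      osc (fun z => iteratedDerivWithin i (fun s => N * (ι l).H z (N * s + -(l : ℕ)))
        (Icc (((l.castSucc : ℕ) : ℝ) / N) ((l.succ : ℕ) / N)) t)
      = N ^ (i + 1) * osc (fun z => iteratedDeriv i ((ι l).H z) (N * t + -(l : ℕ))) := by
    intro i l t ht
    rw [← osc_const_mul (by positivity)]
    congr 1
    ext1 z
    have hlt : (((l.castSucc : ℕ) : ℝ) / N) < ((l.succ : ℕ) / N) :=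
      div_lt_div_of_pos_right (by simp) (by linarith)
    have hsm : ContDiff ℝ ∞ fun s : ℝ => N * (ι l).H z (N * s + -((l : ℕ) : ℝ)) :=
      contDiff_const.mul (((ι l).smooth_H_time z).comp (by fun_prop))
    rw [iteratedDerivWithin_eq_iteratedDeriv (uniqueDiffOn_Icc hlt)
      (hsm.of_le (by exact_mod_cast le_top)).contDiffAt ht,
      iteratedDeriv_comp_affine ((ι l).smooth_H_time z)]
    ring
  have hmem : ∀ l : Fin N, ∀ t ∈ Icc (((l.castSucc : ℕ) : ℝ) / N) ((l.succ : ℕ) / N),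
      (N * t + -((l : ℕ) : ℝ)) ∈ Icc (0 : ℝ) 1 := fun l t ht => by
    obtain ⟨h1, h2⟩ := (mem_Icc_div_iff hN (l := l)).1 ht
    constructor <;> linarith
  rw [HamPath.lengthStar, Finset.range_eq_Ico, Finset.sum_eq_sum_Ico_succ_bot (by omega),
    ENNReal.ofReal_add (by positivity) (by positivity)]
  refine add_le_add ?_ ?_
  · refine iSup_le fun l => iSup₂_le fun t ht => ENNReal.ofReal_le_ofReal ?_
    refine (hterm 0 l t ht).trans_le ?_
    simp only [zero_add, pow_one, iteratedDeriv_zero]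
    exact mul_le_mul_of_nonneg_left (h l l.2 _ (hmem l t ht)).1 (by positivity)
  · have hb : ∀ i ∈ Finset.Ico (0 + 1) (k + 1), (⨆ l : Fin N, ⨆ t ∈
        Icc (((l.castSucc : ℕ) : ℝ) / N) ((l.succ : ℕ) / N), ENNReal.ofReal
        (osc (fun z => iteratedDerivWithin i (fun s => N * (ι l).H z (N * s + -(l : ℕ)))
        (Icc (((l.castSucc : ℕ) : ℝ) / N) ((l.succ : ℕ) / N)) t)))
        ≤ ENNReal.ofReal (N ^ (k + 1) * η) := by
      intro i hi
      rw [Finset.mem_Ico] at hi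
      refine iSup_le fun l => iSup₂_le fun t ht => ENNReal.ofReal_le_ofReal ?_
      rw [hterm i l t ht]
      exact (mul_le_mul_of_nonneg_left
        ((h l l.2 _ (hmem l t ht)).2 i (Finset.mem_Icc.2 ⟨by omega, by omega⟩)) (by positivity)).trans
        (mul_le_mul_of_nonneg_right (pow_le_pow_right₀ hN1 (by omega)) hη)
    refine (Finset.sum_le_sum hb).trans ?_
    rw [Finset.sum_const, Nat.card_Ico, ENNReal.ofReal_mul (Nat.cast_nonneg k),
      ENNReal.ofReal_natCast, nsmul_eq_mul]
    simp

end HamIsotopy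

/-! ### Action functions -/

/-- In a space of dimension at least two, the complement of a closed ball is connected. -/
theorem isPreconnected_compl_closedBall {F : Type*} [NormedAddCommGroup F] [NormedSpace ℝ F]
    (h : 1 < Module.rank ℝ F) (z₀ : F) {D : ℝ} (hD : 0 ≤ D) :
    IsPreconnected (Metric.closedBall z₀ D)ᶜ := by
  have hc := (isConnected_compl_singleton_of_one_lt_rank h (0 : F)).isPreconnected
  -- Pushing outwards radially by D maps the punctured space onto the complement of the ball.
  have him : (fun y : F => z₀ + ((D + ‖y‖) / ‖y‖) • y) '' {0}ᶜ = (Metric.closedBall z₀ D)ᶜ := by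
    ext w
    simp only [mem_image, mem_compl_iff, mem_singleton_iff, Metric.mem_closedBall, not_le,
      dist_eq_norm]
    constructor
    · rintro ⟨y, hy, rfl⟩
      have hy' : 0 < ‖y‖ := norm_pos_iff.2 hy
      rw [add_sub_cancel_left, norm_smul, Real.norm_of_nonneg (by positivity),
        div_mul_cancel₀ _ hy'.ne']
      linarith
    · intro hw
      have hw' : 0 < ‖w - z₀‖ := hD.trans_lt hw
      refine ⟨((‖w - z₀‖ - D) / ‖w - z₀‖) • (w - z₀),
        smul_ne_zero (div_pos (by linarith) hw').ne' (norm_pos_iff.1 hw'), ?_⟩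
      have hn : ‖((‖w - z₀‖ - D) / ‖w - z₀‖) • (w - z₀)‖ = ‖w - z₀‖ - D := by
        rw [norm_smul, Real.norm_of_nonneg (div_nonneg (by linarith) hw'.le),
          div_mul_cancel₀ _ hw'.ne']
      rw [hn, smul_smul]
      have : (D + (‖w - z₀‖ - D)) / (‖w - z₀‖ - D) * ((‖w - z₀‖ - D) / ‖w - z₀‖) = 1 := by
        have : ‖w - z₀‖ - D ≠ 0 := by linarith
        field_simp
        ring
      rw [this, one_smul, add_sub_cancel]
  rw [← him]
  refine hc.image _ (fun y hy => ContinuousAt.continuousWithinAt ?_)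
  have hy' : ‖y‖ ≠ 0 := norm_ne_zero_iff.2 hy
  fun_prop (disch := assumption)

theorem one_lt_rank_E (i : Fin n) : 1 < Module.rank ℝ (E n) := by
  apply Module.one_lt_rank_of_one_lt_finrank
  have : 0 < n := i.pos
  rw [finrank_euclideanSpace, Fintype.card_sum, Fintype.card_fin]
  omega

/-- The difference of the pull-back by `θ` of a primitive of `ω₀` and that primitive. -/
def actionForm (θ : E n → E n) (z₀ z : E n) : E n →L[ℝ] ℝ :=
  (1 / 2 : ℝ) • ((omegaL n (θ z - z₀)).comp (fderiv ℝ θ z) - omegaL n (z - z₀))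

theorem actionForm_apply (θ : E n → E n) (z₀ z u : E n) :
    actionForm θ z₀ z u = 1 / 2 * (omega0 (θ z - z₀) (fderiv ℝ θ z u) - omega0 (z - z₀) u) := by
  show (1 / 2 : ℝ) • (omegaL n (θ z - z₀) (fderiv ℝ θ z u) - omegaL n (z - z₀) u) = _
  rw [omegaL_apply, omegaL_apply, smul_eq_mul]

theorem contDiff_actionForm {θ : E n → E n} (hθ : ContDiff ℝ ∞ θ) (z₀ : E n) :
    ContDiff ℝ ∞ (actionForm θ z₀) := by
  have h1 : ContDiff ℝ ∞ (fderiv ℝ θ) := (contDiff_infty_iff_fderiv.1 hθ).2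
  exact ContDiff.const_smul (1 / 2 : ℝ) ((((omegaL n).contDiff.comp (hθ.sub contDiff_const)).clm_comp h1).sub
    ((omegaL n).contDiff.comp (contDiff_id.sub contDiff_const)))

/-- Of the differentiated terms, ω₀(Dθ v, Dθ u) cancels ω₀(v, u). What remains is symmetric in u and
v, so the action form is closed. -/
theorem fderiv_actionForm {θ : E n → E n} (hθ : ContDiff ℝ ∞ θ)
    (hs : ∀ z u v, omega0 (fderiv ℝ θ z u) (fderiv ℝ θ z v) = omega0 u v) (z₀ z u v : E n) :
    fderiv ℝ (actionForm θ z₀) z v u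
      = 1 / 2 * omega0 (θ z - z₀) (fderiv ℝ (fderiv ℝ θ) z v u) := by
  have h1 : ContDiff ℝ ∞ (fderiv ℝ θ) := (contDiff_infty_iff_fderiv.1 hθ).2
  have hl : HasDerivAt (fun t : ℝ => z + t • v) v 0 := by
    simpa using ((hasDerivAt_id (0 : ℝ)).smul_const v).const_add z
  have hz : z + (0 : ℝ) • v = z := by simp
  have key : ∀ {G : Type} [NormedAddCommGroup G] [NormedSpace ℝ G] {g : E n → G},
      ContDiff ℝ ∞ g → HasDerivAt (fun t : ℝ => g (z + t • v)) (fderiv ℝ g z v) 0 := by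
    intro G _ _ g hg
    have h : HasFDerivAt g (fderiv ℝ g z) (z + (0 : ℝ) • v) := by
      rw [hz]
      exact (hg.differentiable (by simp) z).hasFDerivAt
    exact h.comp_hasDerivAt (0 : ℝ) hl
  have ha := (key (contDiff_actionForm hθ z₀)).clm_apply (hasDerivAt_const (0 : ℝ) u)
  have hb := ((hasDerivAt_omega0 ((key hθ).sub_const z₀)
    ((key h1).clm_apply (hasDerivAt_const (0 : ℝ) u))).sub
      (hasDerivAt_omega0 (hl.sub_const z₀) (hasDerivAt_const (0 : ℝ) u))).const_mul (1 / 2 : ℝ)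
  have he : (fun t : ℝ => actionForm θ z₀ (z + t • v) u) = fun t : ℝ => 1 / 2 *
      (omega0 (θ (z + t • v) - z₀) (fderiv ℝ θ (z + t • v) u) - omega0 (z + t • v - z₀) u) := by
    ext1 t
    rw [actionForm_apply]
  rw [he] at ha
  have := ha.unique hb
  rw [hz] at this
  simpa [hs, ← omegaL_apply] using this

/-- A compactly supported symplectic diffeomorphism has an action function that vanishes outside
of every ball that contains its support. -/
theorem exists_action {θ : E n → E n} (hθ : ContDiff ℝ ∞ θ)
    (hs : ∀ z u v, omega0 (fderiv ℝ θ z u) (fderiv ℝ θ z v) = omega0 u v) (i : Fin n) (z₀ : E n)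
    {D : ℝ} (hD : 0 ≤ D) (hsupp : ∀ z ∉ Metric.closedBall z₀ D, θ z = z) :
    ∃ G : E n → ℝ, ContDiff ℝ ∞ G ∧ (∀ z, HasFDerivAt G (actionForm θ z₀ z) z) ∧
      ∀ z ∉ Metric.closedBall z₀ D, G z = 0 := by
  obtain ⟨G, hG⟩ := convex_univ.exists_forall_hasFDerivAt_of_fderiv_symmetric isOpen_univ
    ((contDiff_actionForm hθ z₀).differentiable (by simp)).differentiableOn (fun z _ u v => by
      rw [fderiv_actionForm hθ hs, fderiv_actionForm hθ hs,
        (hθ.contDiffAt.isSymmSndFDerivAt two_le_infty).eq])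
  have hG' : ∀ z, HasFDerivAt G (actionForm θ z₀ z) z := fun z => hG z (mem_univ z)
  have hsm : ContDiff ℝ ∞ G := by
    refine contDiff_infty_iff_fderiv.2 ⟨fun z => (hG' z).differentiableAt, ?_⟩
    rw [funext fun z => (hG' z).fderiv]
    exact contDiff_actionForm hθ z₀
  have hopen : IsOpen (Metric.closedBall z₀ D)ᶜ := Metric.isClosed_closedBall.isOpen_compl
  have hzero : ∀ z ∉ Metric.closedBall z₀ D, actionForm θ z₀ z = 0 := fun z hz => by
    have h1 : θ =ᶠ[𝓝 z] id := by
      filter_upwards [hopen.mem_nhds hz] with y hy using hsupp y hy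
    ext u
    rw [actionForm_apply, h1.fderiv_eq, h1.eq_of_nhds]
    simp
  -- The Poincaré lemma gives a primitive up to a constant. The form vanishes outside the ball,
  -- whose complement is connected in dimension 2n ≥ 2, so subtracting one constant gives the
  -- compact support.
  obtain ⟨a, ha⟩ := hopen.exists_is_const_of_fderiv_eq_zero
    (isPreconnected_compl_closedBall (one_lt_rank_E i) z₀ hD)
    (fun z _ => (hG' z).differentiableAt.differentiableWithinAt)
    (fun z hz => by rw [(hG' z).fderiv]; exact hzero z hz)
  exact ⟨fun z => G z - a, hsm.sub contDiff_const, fun z => (hG' z).sub_const a,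
    fun z hz => sub_eq_zero.2 (ha z hz)⟩

/-! ### Dilations and C⁰-small isotopies -/

/-- The dilation with centre `z₀` and factor `c`. -/
def dilation (z₀ : E n) (c : ℝ) (hc : c ≠ 0) : Equiv.Perm (E n) where
  toFun z := z₀ + c • (z - z₀)
  invFun z := z₀ + c⁻¹ • (z - z₀)
  left_inv z := by simp [smul_smul, hc]
  right_inv z := by simp [smul_smul, hc]

theorem contDiff_dilation (z₀ : E n) (c : ℝ) (hc : c ≠ 0) : ContDiff ℝ ∞ (dilation z₀ c hc) := by
  show ContDiff ℝ ∞ fun z => z₀ + c • (z - z₀)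
  fun_prop

theorem contDiff_dilation_symm (z₀ : E n) (c : ℝ) (hc : c ≠ 0) :
    ContDiff ℝ ∞ (dilation z₀ c hc).symm := by
  show ContDiff ℝ ∞ fun z => z₀ + c⁻¹ • (z - z₀)
  fun_prop

theorem fderiv_dilation (z₀ : E n) (c : ℝ) (hc : c ≠ 0) (z u : E n) :
    fderiv ℝ (dilation z₀ c hc) z u = c • u := by
  have : HasFDerivAt (fun z => z₀ + c • (z - z₀)) (c • ContinuousLinearMap.id ℝ (E n)) z :=
    (((hasFDerivAt_id z).sub_const z₀).const_smul c).const_add z₀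
  exact DFunLike.congr_fun this.fderiv u

theorem omega0_smul_smul (c : ℝ) (u v : E n) : omega0 (c • u) (c • v) = c ^ 2 * omega0 u v := by
  simp only [← omegaL_apply, map_smul, smul_apply, smul_eq_mul]
  ring

/-- Conjugation of an isotopy by a dilation. -/
def HamIsotopy.dilate (J : HamIsotopy n) (z₀ : E n) (c : ℝ) (hc : c ≠ 0) : HamIsotopy n :=
  J.conj (dilation z₀ c hc) (contDiff_dilation z₀ c hc) (contDiff_dilation_symm z₀ c hc) (c ^ 2)
    fun z u v => by rw [fderiv_dilation, fderiv_dilation, omega0_smul_smul]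

theorem HamIsotopy.dilate_flow_apply (J : HamIsotopy n) (z₀ : E n) (c : ℝ) (hc : c ≠ 0) (t : ℝ)
    (z : E n) :
    (J.dilate z₀ c hc).flow t z = z₀ + c • (J.flow t (z₀ + c⁻¹ • (z - z₀)) - z₀) := rfl

theorem norm_dilate_sub_le (J : HamIsotopy n) (z₀ : E n) {c : ℝ} (hc : 0 < c) {δ : ℝ} {t : ℝ}
    (hδ : ∀ z, ‖J.flow t z - z‖ ≤ δ) (z : E n) :
    ‖(J.dilate z₀ c hc.ne').flow t z - z‖ ≤ c * δ := by
  have : (J.dilate z₀ c hc.ne').flow t z - z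
      = c • (J.flow t (z₀ + c⁻¹ • (z - z₀)) - (z₀ + c⁻¹ • (z - z₀))) := by
    have h : c • (z₀ + c⁻¹ • (z - z₀)) = c • z₀ + (z - z₀) := by
      rw [smul_add, smul_smul, mul_inv_cancel₀ hc.ne', one_smul]
    rw [J.dilate_flow_apply, smul_sub c (J.flow t _), smul_sub c (J.flow t _), h]
    abel
  rw [this, norm_smul, Real.norm_of_nonneg hc.le]
  exact mul_le_mul_of_nonneg_left (hδ _) hc.le

/-- The family of dilated copies of a Hamiltonian diffeomorphism is a Hamiltonian isotopy whose
Hamiltonian functions are given by the action function. -/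
theorem exists_dilation_isotopy (J : HamIsotopy n) (i : Fin n) (z₀ : E n) {D : ℝ} (hD : 0 ≤ D)
    (hsupp : ∀ z ∉ Metric.closedBall z₀ D, J.flow 1 z = z) {l : ℝ → ℝ} (hl : ContDiff ℝ ∞ l)
    (hl0 : ∀ t, 0 < l t) (hl1 : ∀ t, l t ≤ 1) :
    ∃ L : HamIsotopy n, (∀ t, L.flow t = (J.dilate z₀ (l t) (hl0 t).ne').flow 1 *
        ((J.dilate z₀ (l 0) (hl0 0).ne').flow 1)⁻¹) ∧
      ∀ t, ∀ z ∉ Metric.closedBall z₀ D, L.H z t = 0 := by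
  set θ := J.flow 1 with hθdef
  have hθ : ContDiff ℝ ∞ θ := J.smooth_flow_slice 1
  have hθ' : ContDiff ℝ ∞ θ.symm := J.smooth_symm_slice 1
  have hs : ∀ z u v, omega0 (fderiv ℝ θ z u) (fderiv ℝ θ z v) = omega0 u v :=
    fun z u v => J.omega0_D 1 z u v
  obtain ⟨G, hG, hdG, hG0⟩ := exists_action hθ hs i z₀ hD hsupp
  have hne : ∀ t, l t ≠ 0 := fun t => (hl0 t).ne'
  have hinv : ContDiff ℝ ∞ fun t => (l t)⁻¹ := hl.inv hne
  have hpt : ContDiff ℝ ∞ fun p : E n × ℝ => z₀ + (l p.2)⁻¹ • (p.1 - z₀) :=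
    contDiff_const.add ((hinv.comp contDiff_snd).smul (contDiff_fst.sub contDiff_const))
  -- With ζ the argument of G, the velocity of the dilated copies is l'(θζ - z₀ - Dθ(ζ - z₀)). Its
  -- pairing with u is 2 l l' times the action form at ζ applied to Dθ⁻¹(u / l), which dictates the
  -- factor -2 l l'.
  let H : E n → ℝ → ℝ := fun w t =>
    (-2 * l t * deriv l t) * G (θ.symm (z₀ + (l t)⁻¹ • (w - z₀)))
  have hH : ContDiff ℝ ∞ fun p : E n × ℝ => H p.1 p.2 :=
    ((contDiff_const.mul (hl.comp contDiff_snd)).mul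
      ((contDiff_infty_iff_deriv.1 hl).2.comp contDiff_snd)).mul
      (hG.comp (hθ'.comp hpt))
  have hH0 : ∀ t, ∀ z ∉ Metric.closedBall z₀ D, H z t = 0 := by
    intro t z hz
    have h1 : z₀ + (l t)⁻¹ • (z - z₀) ∉ Metric.closedBall z₀ D := by
      rw [Metric.mem_closedBall, dist_eq_norm, not_le] at hz ⊢
      rw [add_sub_cancel_left, norm_smul, Real.norm_of_nonneg (inv_nonneg.2 (hl0 t).le)]
      -- Factors at most 1 shrink the support, so the ball does not have to grow.
      have : 1 ≤ (l t)⁻¹ := (one_le_inv₀ (hl0 t)).2 (hl1 t)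
      nlinarith [norm_nonneg (z - z₀)]
    have h2 : θ.symm (z₀ + (l t)⁻¹ • (z - z₀)) = z₀ + (l t)⁻¹ • (z - z₀) := by
      rw [Equiv.symm_apply_eq, hsupp _ h1]
    simp only [H, h2, hG0 _ h1, mul_zero]
  have hflow : ∀ y t, HasDerivAt (fun s => (J.dilate z₀ (l s) (hne s)).flow 1 y)
      (hamVF (fun x => H x t) ((J.dilate z₀ (l t) (hne t)).flow 1 y)) t := by
    intro y t
    set ζ := z₀ + (l t)⁻¹ • (y - z₀) with hζ
    have hyζ : l t • (ζ - z₀) = y - z₀ := by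
      rw [hζ, add_sub_cancel_left, smul_smul, mul_inv_cancel₀ (hne t), one_smul]
    have hlt : HasDerivAt l (deriv l t) t := (hl.differentiable (by simp) t).hasDerivAt
    have h1 : HasDerivAt (fun s => z₀ + (l s)⁻¹ • (y - z₀))
        ((-deriv l t / l t ^ 2) • (y - z₀)) t :=
      ((hlt.inv (hne t)).smul_const _).const_add z₀
    have h2 : HasDerivAt (fun s => θ (z₀ + (l s)⁻¹ • (y - z₀)))
        (fderiv ℝ θ ζ ((-deriv l t / l t ^ 2) • (y - z₀))) t :=
      ((hθ.differentiable (by simp)) ζ).hasFDerivAt.comp_hasDerivAt t h1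
    have h3 : HasDerivAt (fun s => (J.dilate z₀ (l s) (hne s)).flow 1 y)
        (l t • fderiv ℝ θ ζ ((-deriv l t / l t ^ 2) • (y - z₀)) + deriv l t • (θ ζ - z₀)) t :=
      (hlt.smul (h2.sub_const z₀)).const_add z₀
    have h4 : l t • fderiv ℝ θ ζ ((-deriv l t / l t ^ 2) • (y - z₀)) + deriv l t • (θ ζ - z₀)
        = deriv l t • (θ ζ - z₀ - fderiv ℝ θ ζ (ζ - z₀)) := by
      have : l t * (-deriv l t / l t ^ 2 * l t) = -deriv l t := by
        have := hne t
        field_simp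
      rw [← hyζ, smul_smul, map_smul, smul_smul, this]
      module
    rw [h4] at h3
    refine h3.congr_deriv (eq_hamVF fun u => ?_)
    have hw : (J.dilate z₀ (l t) (hne t)).flow 1 y = z₀ + l t • (θ ζ - z₀) := rfl
    rw [hw]
    have hback : θ.symm (z₀ + (l t)⁻¹ • (z₀ + l t • (θ ζ - z₀) - z₀)) = ζ := by
      rw [add_sub_cancel_left, smul_smul, inv_mul_cancel₀ (hne t), one_smul, add_sub_cancel,
        Equiv.symm_apply_apply]
    have hback' : z₀ + (l t)⁻¹ • (z₀ + l t • (θ ζ - z₀) - z₀) = θ ζ :=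
      (Equiv.symm_apply_eq _).1 hback
    have hdin : HasFDerivAt (fun x => z₀ + (l t)⁻¹ • (x - z₀))
        ((l t)⁻¹ • ContinuousLinearMap.id ℝ (E n)) (z₀ + l t • (θ ζ - z₀)) :=
      (((hasFDerivAt_id _).sub_const z₀).const_smul (l t)⁻¹).const_add z₀
    have hdθ : HasFDerivAt θ.symm (fderiv ℝ θ.symm (θ ζ))
        (z₀ + (l t)⁻¹ • (z₀ + l t • (θ ζ - z₀) - z₀)) := by
      rw [hback']
      exact (hθ'.differentiable (by simp) _).hasFDerivAt
    have hdG' : HasFDerivAt G (actionForm θ z₀ ζ)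
        (θ.symm (z₀ + (l t)⁻¹ • (z₀ + l t • (θ ζ - z₀) - z₀))) := by
      rw [hback]
      exact hdG ζ
    have hdθ' : HasFDerivAt (fun x => θ.symm (z₀ + (l t)⁻¹ • (x - z₀)))
        ((fderiv ℝ θ.symm (θ ζ)).comp ((l t)⁻¹ • ContinuousLinearMap.id ℝ (E n)))
        (z₀ + l t • (θ ζ - z₀)) :=
      HasFDerivAt.comp (g := θ.symm) (f := fun x => z₀ + (l t)⁻¹ • (x - z₀)) _ hdθ hdin
    have hdH := ((HasFDerivAt.comp (g := G)
      (f := fun x => θ.symm (z₀ + (l t)⁻¹ • (x - z₀))) _ hdG' hdθ').const_mul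
      (-2 * l t * deriv l t))
    have hdH' : fderiv ℝ (fun x => H x t) (z₀ + l t • (θ ζ - z₀)) u
        = -2 * l t * deriv l t * actionForm θ z₀ ζ
          (fderiv ℝ θ.symm (θ ζ) ((l t)⁻¹ • u)) := DFunLike.congr_fun hdH.fderiv u
    have hDD : fderiv ℝ θ ζ (fderiv ℝ θ.symm (θ ζ) u) = u := by
      have e1 : HasFDerivAt (θ ∘ θ.symm) ((fderiv ℝ θ ζ).comp (fderiv ℝ θ.symm (θ ζ))) (θ ζ) := by
        have h : HasFDerivAt θ (fderiv ℝ θ ζ) (θ.symm (θ ζ)) := by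
          rw [Equiv.symm_apply_apply]
          exact (hθ.differentiable (by simp) _).hasFDerivAt
        exact h.comp (θ ζ) (hθ'.differentiable (by simp) _).hasFDerivAt
      have e2 : θ ∘ θ.symm = id := by ext1 w; simp
      rw [e2] at e1
      exact DFunLike.congr_fun (e1.unique (hasFDerivAt_id _)) u
    have hpull : omega0 (ζ - z₀) (fderiv ℝ θ.symm (θ ζ) u)
        = omega0 (fderiv ℝ θ ζ (ζ - z₀)) u := by
      rw [← hs ζ (ζ - z₀), hDD]
    rw [hdH', map_smul, map_smul, actionForm_apply, hDD, hpull, smul_eq_mul]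
    simp only [← omegaL_apply, map_smul, map_sub, smul_apply, smul_eq_mul,
      sub_apply]
    have := hne t
    field_simp
  refine ⟨⟨H, fun t => (J.dilate z₀ (l t) (hne t)).flow 1 *
      ((J.dilate z₀ (l 0) (hne 0)).flow 1)⁻¹, hH,
      ⟨_, isCompact_closedBall z₀ D, hH0⟩, ?_, ?_, by simp, fun z t => hflow _ t⟩,
    fun t => rfl, hH0⟩
  · have h := hpt.comp (((((J.dilate z₀ (l 0) (hne 0)).smooth_symm_slice 1).comp
      contDiff_fst).prodMk contDiff_snd :
      ContDiff ℝ ∞ fun p : E n × ℝ => (((J.dilate z₀ (l 0) (hne 0)).flow 1).symm p.1, p.2)))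
    exact contDiff_const.add ((hl.comp contDiff_snd).smul ((hθ.comp h).sub contDiff_const))
  · have h : ContDiff ℝ ∞ fun p : E n × ℝ =>
        z₀ + l p.2 • (θ.symm (z₀ + (l p.2)⁻¹ • (p.1 - z₀)) - z₀) :=
      contDiff_const.add ((hl.comp contDiff_snd).smul ((hθ'.comp hpt).sub contDiff_const))
    exact ((J.dilate z₀ (l 0) (hne 0)).smooth_flow_slice 1).comp h

/-- A `C⁰`-small isotopy from the identity to a Hamiltonian diffeomorphism, up to a small factor. -/
theorem exists_small_isotopy (J : HamIsotopy n) (i : Fin n) (z₀ : E n) {D : ℝ} (hD : 0 ≤ D)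
    (hsupp : ∀ z ∉ Metric.closedBall z₀ D, J.flow 1 z = z) {δ : ℝ}
    (hδ : ∀ z, ‖J.flow 1 z - z‖ ≤ δ) {ε : ℝ} (hε : 0 < ε) (hε1 : ε ≤ 1) :
    ∃ L : HamIsotopy n, L.flow 1 * (J.dilate z₀ ε hε.ne').flow 1 = J.flow 1 ∧
      (∀ t z, ‖L.flow t z - z‖ ≤ (1 + ε) * δ) ∧
      ∀ t, ∀ z ∉ Metric.closedBall z₀ D, L.H z t = 0 := by
  have hδ0 : 0 ≤ δ := (norm_nonneg _).trans (hδ z₀)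
  -- This is Alexander's trick stopped at ε > 0: the dilation degenerates at factor 0, so a copy
  -- scaled by ε is left over.
  let l : ℝ → ℝ := fun t => ε + (1 - ε) * Real.smoothTransition t
  have hl : ContDiff ℝ ∞ l :=
    contDiff_const.add (contDiff_const.mul Real.smoothTransition.contDiff)
  have hl0 : ∀ t, 0 < l t := fun t => by
    have := mul_nonneg (sub_nonneg.2 hε1) (Real.smoothTransition.nonneg t)
    simp only [l]; linarith
  have hl1 : ∀ t, l t ≤ 1 := fun t => by
    have := mul_le_of_le_one_right (sub_nonneg.2 hε1) (Real.smoothTransition.le_one t)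
    simp only [l]; linarith
  obtain ⟨L, hL, hL0⟩ := exists_dilation_isotopy J i z₀ hD hsupp hl hl0 hl1
  have e0 : l 0 = ε := by simp [l]
  have e1 : l 1 = 1 := by simp [l]
  refine ⟨L, ?_, fun t z => ?_, hL0⟩
  · rw [hL 1]
    simp only [e0]
    rw [inv_mul_cancel_right]
    ext1 z
    simp [J.dilate_flow_apply, e1]
  · rw [hL t]
    simp only [e0]
    set w := ((J.dilate z₀ ε hε.ne').flow 1)⁻¹ z with hw
    have hz : z = (J.dilate z₀ ε hε.ne').flow 1 w := by simp [hw]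
    have h1 := norm_dilate_sub_le J z₀ (hl0 t) hδ w
    have h2 := norm_dilate_sub_le J z₀ hε hδ w
    rw [← hz] at h2
    have h3 : l t * δ ≤ 1 * δ := mul_le_mul_of_nonneg_right (hl1 t) hδ0
    calc ‖(J.dilate z₀ (l t) (hl0 t).ne').flow 1 w - z‖
        = ‖((J.dilate z₀ (l t) (hl0 t).ne').flow 1 w - w) - (z - w)‖ := by congr 1; abel
      _ ≤ l t * δ + ε * δ := (norm_sub_le _ _).trans (add_le_add h1 h2)
      _ ≤ (1 + ε) * δ := by linarith

/-! ### A smooth staircase function -/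

/-- A smooth step from `0` to `1` inside of `[7 / 8, 1]`. -/
def smoothStep (u : ℝ) : ℝ := Real.smoothTransition (16 * (u - 29 / 32))

theorem contDiff_smoothStep : ContDiff ℝ ∞ smoothStep :=
  Real.smoothTransition.contDiff.comp (by fun_prop : ContDiff ℝ ∞ fun u : ℝ => 16 * (u - 29 / 32))

theorem smoothStep_eq_zero {u : ℝ} (h : u ≤ 29 / 32) : smoothStep u = 0 :=
  Real.smoothTransition.zero_of_nonpos (by linarith)

theorem smoothStep_eq_one {u : ℝ} (h : 31 / 32 ≤ u) : smoothStep u = 1 :=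
  Real.smoothTransition.one_of_one_le (by linarith)

theorem smoothStep_mem_Icc (u : ℝ) : smoothStep u ∈ Icc (0 : ℝ) 1 :=
  ⟨Real.smoothTransition.nonneg _, Real.smoothTransition.le_one _⟩

/-- A smooth function that is equal to `m` on `[m, m + 7 / 8]` for all integers `m`. -/
def stair (x : ℝ) : ℝ := ⌊x⌋ + smoothStep (Int.fract x)

/-- The step is complete at 31/32, so the formula extends to the left of m; this overlap gives
smoothness at the integers. -/
theorem stair_eq {m : ℤ} {x : ℝ} (hx : x ∈ Ioo (m - 1 / 32 : ℝ) (m + 1)) :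
    stair x = m + smoothStep (x - m) := by
  by_cases h : (m : ℝ) ≤ x
  · have : ⌊x⌋ = m := Int.floor_eq_iff.2 ⟨h, hx.2⟩
    rw [stair, Int.fract, this]
  · have : ⌊x⌋ = m - 1 := by
      rw [Int.floor_eq_iff]
      push_cast
      constructor <;> linarith [hx.1]
    rw [stair, Int.fract, this, smoothStep_eq_zero (u := x - m) (by linarith), smoothStep_eq_one]
    · push_cast; ring
    · push_cast
      linarith [hx.1]

theorem contDiff_stair : ContDiff ℝ ∞ stair := by
  refine contDiff_iff_contDiffAt.2 fun x => ?_
  have h : ContDiffAt ℝ ∞ (fun y : ℝ => (⌊x⌋ : ℝ) + smoothStep (y - ⌊x⌋)) x :=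
    (contDiff_const.add (contDiff_smoothStep.comp (contDiff_id.sub contDiff_const))).contDiffAt
  refine h.congr_of_eventuallyEq ?_
  filter_upwards [Ioo_mem_nhds (show (⌊x⌋ : ℝ) - 1 / 32 < x by linarith [Int.floor_le x])
    (Int.lt_floor_add_one x)] with y hy using stair_eq hy

theorem stair_eq_intCast {m : ℤ} {x : ℝ} (hx : x ∈ Ioo (m - 1 / 32 : ℝ) (m + 29 / 32)) :
    stair x = m := by
  rw [stair_eq ⟨hx.1, by linarith [hx.2]⟩, smoothStep_eq_zero (by linarith [hx.2]), add_zero]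

/-- The step starts only at 29/32, so the difference drops at most slightly below 0. The resulting
oscillation 9/8 is the one in the cost of a shift. -/
theorem sub_stair_mem_Icc (x : ℝ) : x - stair x ∈ Icc (-(1 / 8) : ℝ) 1 := by
  have h1 := smoothStep_mem_Icc (Int.fract x)
  have h2 := Int.fract_nonneg x
  have h3 := Int.fract_lt_one x
  have h4 : x - stair x = Int.fract x - smoothStep (Int.fract x) := by
    rw [stair, Int.fract]; ring
  rw [h4]
  by_cases h : Int.fract x ≤ 29 / 32
  · rw [smoothStep_eq_zero h]
    constructor <;> linarith
  · constructor <;> linarith [h1.1, h1.2]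

theorem stair_of_fract_le {x : ℝ} (h : Int.fract x ≤ 7 / 8) : ∀ᶠ y in 𝓝 x, stair y = ⌊x⌋ := by
  have h1 := Int.floor_add_fract x
  have h2 := Int.fract_nonneg x
  filter_upwards [Ioo_mem_nhds (show (⌊x⌋ : ℝ) - 1 / 32 < x by linarith)
    (show x < ⌊x⌋ + 29 / 32 by linarith)] with y hy using stair_eq_intCast hy

/-- The jump of `Int.fract` does no harm: the complement consists of the open gaps (m + 7/8, m + 1).
-/
theorem isClosed_fract_le : IsClosed {x : ℝ | Int.fract x ≤ 7 / 8} := by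
  have : {x : ℝ | Int.fract x ≤ 7 / 8}ᶜ = ⋃ m : ℤ, Ioo (m + 7 / 8 : ℝ) (m + 1) := by
    ext x
    simp only [mem_compl_iff, mem_ofPred_eq, not_le, mem_iUnion, mem_Ioo]
    constructor
    · intro h
      exact ⟨⌊x⌋, by linarith [Int.floor_add_fract x], Int.lt_floor_add_one x⟩
    · rintro ⟨m, h1, h2⟩
      have : ⌊x⌋ = m := Int.floor_eq_iff.2 ⟨by linarith, h2⟩
      rw [Int.fract, this]
      linarith
  rw [← isOpen_compl_iff, this]
  exact isOpen_iUnion fun m => isOpen_Ioo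

/-- A smooth periodic function with values in `[0, 1]` that is adapted to the strips
`{x | fract x ≤ 7 / 8}`. -/
def stripCutoff (x : ℝ) : ℝ := stair (x + 7 / 8) - stair (x + 1 / 8)

theorem contDiff_stripCutoff : ContDiff ℝ ∞ stripCutoff :=
  (contDiff_stair.comp (contDiff_id.add contDiff_const)).sub
    (contDiff_stair.comp (contDiff_id.add contDiff_const))

theorem stripCutoff_eq_zero {x : ℝ} (h : 7 / 8 < Int.fract x) : stripCutoff x = 0 := by
  have h1 := Int.floor_add_fract x
  have h2 := Int.fract_lt_one x
  have h3 : stair (x + 7 / 8) = (⌊x⌋ + 1 : ℤ) :=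
    stair_eq_intCast (by push_cast; constructor <;> linarith)
  have h4 : stair (x + 1 / 8) = (⌊x⌋ + 1 : ℤ) :=
    stair_eq_intCast (by push_cast; constructor <;> linarith)
  rw [stripCutoff, h3, h4, sub_self]

/-- The plateau contains the 1/4-neighbourhood of (m + 3/8, m + 1/2), a gap of the strips with
offset 1/2. -/
theorem stripCutoff_eq_one {m : ℤ} {x : ℝ} (hx : x ∈ Ioo (m + 3 / 32 : ℝ) (m + 25 / 32)) :
    stripCutoff x = 1 := by
  obtain ⟨h1, h2⟩ := hx
  have h3 : stair (x + 7 / 8) = (m + 1 : ℤ) :=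
    stair_eq_intCast (by push_cast; constructor <;> linarith)
  have h4 : stair (x + 1 / 8) = m := stair_eq_intCast (by constructor <;> linarith)
  rw [stripCutoff, h3, h4]
  push_cast
  ring

/-! ### Disjoint unions of isotopies -/

namespace HamIsotopy

theorem flow_mem (J : HamIsotopy n) {S : Set (E n)} (hS : IsClosed S)
    (h : ∀ t, ∀ z ∉ S, J.H z t = 0) (t : ℝ) {z : E n} (hz : z ∈ S) : J.flow t z ∈ S := by
  by_contra hn
  have h1 := J.flow_eq_self hS h t hn
  rw [(J.flow t).injective h1] at hn
  exact hn hz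

/-- Isotopies with disjoint supports can be carried out simultaneously. -/
theorem exists_disjointUnion {ι : Type*} [Fintype ι] (J : ι → HamIsotopy n) {S : ι → Set (E n)}
    (hS : ∀ p, IsClosed (S p)) (hd : ∀ p q, p ≠ q → ∀ z ∈ S p, z ∉ S q)
    (h : ∀ p t, ∀ z ∉ S p, (J p).H z t = 0) :
    ∃ L : HamIsotopy n, (∀ z t, L.H z t = ∑ p, (J p).H z t) ∧
      (∀ t p, ∀ z ∈ S p, L.flow t z = (J p).flow t z) ∧
      ∀ t z, (∀ p, z ∉ S p) → L.flow t z = z := by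
  choose K hK hK0 using fun p => (J p).compact_H
  obtain ⟨L, hL⟩ := exists_hamIsotopy (H := fun z t => ∑ p, (J p).H z t)
    (ContDiff.sum fun p _ => (J p).smooth_H) (isCompact_iUnion hK) (fun t z hz =>
      Finset.sum_eq_zero fun p _ => hK0 p t z fun hz' => hz (mem_iUnion.2 ⟨p, hz'⟩))
  refine ⟨L, fun z t => by rw [hL], fun t p z hz => ?_, fun t z hz => ?_⟩
  · have hc := L.flow_eq_of_hasDerivAt (c := fun t => (J p).flow t z) (fun s => by
      have hm := (J p).flow_mem (hS p) (h p) s hz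
      have : (fun y => L.H y s) =ᶠ[𝓝 ((J p).flow s z)] fun y => (J p).H y s := by
        -- Finitely many closed disjoint sets: near a point of S p only the p-th Hamiltonian is
        -- present, so orbits of J p are orbits of the union.
        have hU : ∀ q, ∀ᶠ y in 𝓝 ((J p).flow s z), q ≠ p → y ∉ S q := fun q => by
          by_cases hq : q = p
          · exact Eventually.of_forall fun y hq' => absurd hq hq'
          · filter_upwards [(hS q).isOpen_compl.mem_nhds (hd p q (Ne.symm hq) _ hm)] with y hy _
              using hy
        filter_upwards [eventually_all.2 hU] with y hy
        rw [hL]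
        exact Finset.sum_eq_single p (fun q _ hq => h q s y (hy q hq)) (by simp)
      rw [hamVF_congr this]
      exact (J p).hasDerivAt z s) t
    simpa [(J p).flow_zero] using hc
  · refine L.flow_eq_self (isClosed_iUnion_of_finite hS) (fun s y hy => ?_) t
      (z := z) (by simpa using hz)
    rw [hL]
    exact Finset.sum_eq_zero fun p _ => h p s y fun hy' => hy (mem_iUnion.2 ⟨p, hy'⟩)

/-- The oscillations of a disjoint union of isotopies. -/
theorem oscBound_of_eq_sum {ι : Type*} [Fintype ι] (J : ι → HamIsotopy n) {S : ι → Set (E n)}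
    (hd : ∀ p q, p ≠ q → ∀ z ∈ S p, z ∉ S q)
    (h : ∀ p t, ∀ z ∉ S p, (J p).H z t = 0) {L : HamIsotopy n}
    (hL : ∀ z t, L.H z t = ∑ p, (J p).H z t) {k : ℕ} {M : ℝ} (hM : 0 ≤ M)
    (hb : ∀ p, ∀ t ∈ Icc (0 : ℝ) 1, ∀ i ≤ k, ∀ z, |iteratedDeriv i ((J p).H z) t| ≤ M) :
    L.OscBound k (2 * M) (2 * M) := by
  have key : ∀ t ∈ Icc (0 : ℝ) 1, ∀ i ≤ k, osc (fun z => iteratedDeriv i (L.H z) t) ≤ 2 * M := by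
    intro t ht i hi
    have hz : ∀ z, |iteratedDeriv i (L.H z) t| ≤ M := by
      intro z
      -- At most one summand is present at each point, so the bound does not grow with the number of
      -- pieces.
      by_cases hz : ∃ p, z ∈ S p
      · obtain ⟨p, hp⟩ := hz
        have : L.H z = (J p).H z := by
          ext1 s
          rw [hL]
          exact Finset.sum_eq_single p
            (fun q _ hq => h q s z (hd p q (Ne.symm hq) z hp)) (by simp)
        rw [this]
        exact hb p t ht i hi z
      · have : L.H z = fun _ => 0 := by
          ext1 s
          rw [hL]
          exact Finset.sum_eq_zero fun p _ => h p s z fun hp => hz ⟨p, hp⟩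
        rw [this, iteratedDeriv_const]
        simpa using hM
    refine (osc_le (m := -M) (M := M) fun z => abs_le.1 (hz z)).trans (by linarith)
  refine fun t ht => ⟨by simpa using key t ht 0 (Nat.zero_le k), fun i hi => ?_⟩
  exact key t ht i (Finset.mem_Icc.1 hi).2

end HamIsotopy

/-! ### Displacement -/

theorem contDiff_iteratedDeriv_time {H : E n → ℝ → ℝ}
    (hH : ContDiff ℝ ∞ fun p : E n × ℝ => H p.1 p.2) (i : ℕ) :
    ContDiff ℝ ∞ fun p : E n × ℝ => iteratedDeriv i (H p.1) p.2 := by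
  induction i generalizing H with
  | zero => simpa using hH
  | succ i ih =>
    simp only [iteratedDeriv_succ']
    refine ih (H := fun z => deriv (H z)) ?_
    have : (fun p : E n × ℝ => deriv (H p.1) p.2) = fun p : E n × ℝ =>
        fderiv ℝ (fun p : E n × ℝ => H p.1 p.2) p (0, 1) := by
      ext1 p
      have h1 : HasDerivAt (fun t : ℝ => (p.1, t)) ((0 : E n), (1 : ℝ)) p.2 :=
        (hasDerivAt_const _ _).prodMk (hasDerivAt_id _)
      exact (((hH.differentiable (by simp)) p).hasFDerivAt.comp_hasDerivAt p.2 h1).deriv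
    rw [this]
    exact (contDiff_infty_iff_fderiv.1 hH).2.clm_apply contDiff_const

namespace HamIsotopy

theorem exists_bound_iteratedDeriv (J : HamIsotopy n) (k : ℕ) (a b : ℝ) :
    ∃ M : ℝ, 0 ≤ M ∧ ∀ t ∈ Icc a b, ∀ i ≤ k, ∀ z, |iteratedDeriv i (J.H z) t| ≤ M := by
  obtain ⟨K, hK, hK0⟩ := J.compact_H
  choose C hC using fun i : ℕ => exists_bound_of_compact_support
    (contDiff_iteratedDeriv_time J.smooth_H i).continuous hK (fun t z hz => by
      have : J.H z = fun _ => 0 := funext fun t => hK0 t z hz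
      simp [this]) a b
  refine ⟨∑ i ∈ Finset.range (k + 1), (C i : ℝ), Finset.sum_nonneg fun i _ => (C i).2,
    fun t ht i hi z => ?_⟩
  exact (hC i z t ht).trans (Finset.single_le_sum (f := fun i => (C i : ℝ))
    (fun i _ => (C i).2) (Finset.mem_range.2 (by omega)))

/-- Time derivatives vanish, so such pieces cost nothing in the orders i ≥ 1, whatever `k` is. -/
theorem oscBound_of_autonomous {L : HamIsotopy n} {G : E n → ℝ} (hL : ∀ z t, L.H z t = G z)
    {m M : ℝ} (hG : ∀ z, G z ∈ Icc m M) (k : ℕ) : L.OscBound k (M - m) 0 := by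
  have : ∀ z, L.H z = fun _ => G z := fun z => funext fun t => hL z t
  refine fun t _ => ⟨by simpa only [hL] using osc_le hG, fun i hi => ?_⟩
  have hi' : i ≠ 0 := by
    have := (Finset.mem_Icc.1 hi).1
    omega
  simp [this, iteratedDeriv_const, hi', osc]

/-- Conjugation of an isotopy by a translation. -/
def translate (J : HamIsotopy n) (w : E n) : HamIsotopy n :=
  J.conj (Equiv.addRight w) (contDiff_id.add contDiff_const) (contDiff_id.add contDiff_const) 1
    fun z u v => by
      have : fderiv ℝ (Equiv.addRight w) z = ContinuousLinearMap.id ℝ (E n) :=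
        ((hasFDerivAt_id z).add_const w).fderiv
      rw [this, one_mul]
      rfl

theorem translate_flow_apply (J : HamIsotopy n) (w z : E n) (t : ℝ) :
    (J.translate w).flow t z = J.flow t (z - w) + w := by
  rw [sub_eq_add_neg]; rfl

theorem translate_H (J : HamIsotopy n) (w z : E n) (t : ℝ) :
    (J.translate w).H z t = J.H (z - w) t := by
  rw [sub_eq_add_neg]; exact one_mul _

end HamIsotopy

/-- The intersection of a ball with parallel strips. -/
def strips (i : Fin n) (z₀ : E n) (D W o : ℝ) : Set (E n) :=
  Metric.closedBall z₀ D ∩ {z | Int.fract (z (Sum.inl i) / W - o) ≤ 7 / 8}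

theorem isClosed_strips (i : Fin n) (z₀ : E n) (D W o : ℝ) : IsClosed (strips i z₀ D W o) :=
  Metric.isClosed_closedBall.inter (isClosed_fract_le.preimage
    (by fun_prop : Continuous fun z : E n => z (Sum.inl i) / W - o))

/-- An autonomous isotopy with small oscillation that translates the strips in a ball. -/
theorem exists_shift (i : Fin n) (z₀ : E n) {R W S : ℝ} (o : ℝ) (hR : 0 ≤ R) (hW : 0 < W)
    (hS : 0 ≤ S) :
    ∃ (g : HamIsotopy n) (G : E n → ℝ), (∀ z t, g.H z t = G z) ∧
      (∀ z, G z ∈ Icc (-(S * W * (1 / 8))) (S * W)) ∧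
      ∀ z ∈ strips i z₀ R W o, g.flow 1 z = z + S • EuclideanSpace.single (Sum.inr i) 1 := by
  -- The cutoff is 1 along the whole translation by S of the ball of radius R.
  let ρ : ContDiffBump z₀ := ⟨R + S + 1, R + S + 2, by linarith, by linarith⟩
  let X : E n → ℝ := fun z => z (Sum.inl i) / W - o
  have hX : ContDiff ℝ ∞ X := by
    have : ContDiff ℝ ∞ fun z : E n => z (Sum.inl i) :=
      (EuclideanSpace.proj (Sum.inl i) : E n →L[ℝ] ℝ).contDiff
    exact (this.div_const W).sub contDiff_const
  -- On each strip the staircase is locally constant, so G is S·x_i up to a constant and its field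
  -- is S ∂/∂y_i. Subtracting the staircase keeps G of size SW for any number of strips.
  let G : E n → ℝ := fun z => S * W * (X z - stair (X z)) * ρ z
  have hG : ContDiff ℝ ∞ G :=
    (contDiff_const.mul (hX.sub (contDiff_stair.comp hX))).mul ρ.contDiff
  obtain ⟨g, hg⟩ := exists_hamIsotopy (H := fun z _ => G z) (hG.comp contDiff_fst)
    (isCompact_closedBall z₀ ρ.rOut) (fun _ z hz => by
      rw [Metric.mem_closedBall, not_le] at hz
      simp only [G, ρ.zero_of_le_dist hz.le, mul_zero])
  refine ⟨g, G, fun z t => by rw [hg], fun z => ?_, fun z hz => ?_⟩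
  · have h1 := sub_stair_mem_Icc (X z)
    have h2 : 0 ≤ ρ z := ρ.nonneg
    have h3 : ρ z ≤ 1 := ρ.le_one
    have h4 : 0 ≤ S * W := by positivity
    constructor
    · have : 0 ≤ (X z - stair (X z) + 1 / 8) * ρ z := mul_nonneg (by linarith [h1.1]) h2
      have : -(1 / 8) ≤ (X z - stair (X z)) * ρ z := by nlinarith
      calc -(S * W * (1 / 8)) = S * W * (-(1 / 8)) := by ring
        _ ≤ S * W * ((X z - stair (X z)) * ρ z) := mul_le_mul_of_nonneg_left this h4
        _ = G z := by simp only [G]; ring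
    · have : 0 ≤ (1 - (X z - stair (X z))) * ρ z := mul_nonneg (by linarith [h1.2]) h2
      have : (X z - stair (X z)) * ρ z ≤ 1 := by nlinarith
      calc G z = S * W * ((X z - stair (X z)) * ρ z) := by simp only [G]; ring
        _ ≤ S * W * 1 := mul_le_mul_of_nonneg_left this h4
        _ = S * W := mul_one _
  · set v : E n := S • EuclideanSpace.single (Sum.inr i) (1 : ℝ) with hv
    have hvn : ‖v‖ = S := by
      rw [hv, norm_smul, PiLp.norm_single, norm_one, mul_one, Real.norm_of_nonneg hS]
    have hvi : v (Sum.inl i) = 0 := by simp [hv]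
    have hc : ∀ t ∈ Icc (0 : ℝ) 1, HasDerivWithinAt (fun t : ℝ => z + t • v)
        (hamVF (fun y => g.H y t) (z + t • v)) (Icc 0 1) t := by
      intro t ht
      have hd : HasDerivAt (fun t : ℝ => z + t • v) v t := by
        simpa using ((hasDerivAt_id t).smul_const v).const_add z
      refine (hd.congr_deriv (eq_hamVF fun w => ?_)).hasDerivWithinAt
      have hXt : X (z + t • v) = X z := by simp [X, hvi]
      have hball : z + t • v ∈ Metric.ball z₀ ρ.rIn := by
        have h1 : dist z z₀ ≤ R := hz.1
        have h2 : ‖t • v‖ ≤ S := by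
          rw [norm_smul, hvn, Real.norm_of_nonneg ht.1]
          exact mul_le_of_le_one_left hS ht.2
        rw [Metric.mem_ball]
        calc dist (z + t • v) z₀ ≤ dist (z + t • v) z + dist z z₀ := dist_triangle _ _ _
          _ ≤ S + R := by
            rw [dist_eq_norm, add_sub_cancel_left]
            exact add_le_add h2 h1
          _ < R + S + 1 := by linarith
      have h1 : ∀ᶠ y in 𝓝 (z + t • v), stair (X y) = ⌊X z⌋ := by
        have h := stair_of_fract_le (x := X (z + t • v)) (by rw [hXt]; exact hz.2)
        rw [hXt] at h
        exact (hXt ▸ hX.continuous.continuousAt : Tendsto X (𝓝 (z + t • v)) (𝓝 (X z))).eventually h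
      have h2 : (fun y => g.H y t) =ᶠ[𝓝 (z + t • v)] fun y =>
          S * y (Sum.inl i) - S * W * (o + ⌊X z⌋) := by
        filter_upwards [h1, ρ.eventuallyEq_one_of_mem_ball hball] with y hy1 hy2
        rw [hg]
        simp only [G, hy1, hy2, Pi.one_apply, X]
        field_simp
        ring
      have h3 : HasFDerivAt (fun y : E n => S * y (Sum.inl i) - S * W * (o + ⌊X z⌋))
          (S • (EuclideanSpace.proj (Sum.inl i) : E n →L[ℝ] ℝ))
          (z + t • v) :=
        ((EuclideanSpace.proj (Sum.inl i) : E n →L[ℝ] ℝ).hasFDerivAt.const_mul S).sub_const _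
      rw [h2.fderiv_eq, h3.fderiv, omega0_antisymm, hv, ← omegaL_apply, map_smul, omegaL_apply,
        omega0_single_inr]
      simp
    have := g.flow_eq_of_hasDerivWithinAt hc 1 ⟨zero_le_one, le_rfl⟩
    simpa using this

/-- The telescoping identity behind the displacement trick: `g` displaces the disjoint copies
`U + w p` of `U` one step further, `Φ` acts by `φ p` on the `p`-th copy and `Ψ` by
`φ p * (φ (p + 1))⁻¹` on the `(p + 1)`-st one. -/
theorem eq_commutator_mul {X : Type*} [AddCommGroup X] {U : Set X} {w : ℕ → X} (hw0 : w 0 = 0)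
    (hd : ∀ p q, p ≠ q → ∀ z, z - w p ∈ U → z - w q ∉ U) {N : ℕ} {φ : ℕ → Equiv.Perm X}
    (hφN : φ N = 1) (hmem : ∀ p, ∀ z ∈ U, φ p z ∈ U) (hout : ∀ z ∉ U, φ 0 z = z)
    {g Φ Ψ : Equiv.Perm X} (hg : ∀ p < N, ∀ z ∈ U, g (z + w p) = z + w (p + 1))
    (hΦ : ∀ p ≤ N, ∀ z ∈ U, Φ (z + w p) = φ p z + w p)
    (hΦ' : ∀ z, (∀ p ≤ N, z - w p ∉ U) → Φ z = z)
    (hΨ : ∀ p < N, ∀ z ∈ U, Ψ (φ (p + 1) z + w (p + 1)) = φ p z + w (p + 1))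
    (hΨ' : ∀ z, (∀ p < N, z - w (p + 1) ∉ U) → Ψ z = z) :
    φ 0 = Φ * g * Φ⁻¹ * g⁻¹ * Ψ := by
  -- On the p-th copy with p < N, both sides send z + w p to φ (p + 1) z + w (p + 1). Elsewhere Φ is
  -- the identity, because φ N = 1, and Ψ fixes g y, so only copy 0 has to be compared, where Φ and
  -- φ 0 agree.
  have key : φ 0 * Ψ⁻¹ * g * Φ = Φ * g := by
    ext1 y
    simp only [Equiv.Perm.mul_apply]
    by_cases h : ∃ p < N, y - w p ∈ U
    · obtain ⟨p, hp, hz⟩ := h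
      obtain ⟨z, rfl⟩ : ∃ z, y = z + w p := ⟨y - w p, (sub_add_cancel _ _).symm⟩
      rw [add_sub_cancel_right] at hz
      have h1 : φ (p + 1) z + w (p + 1) ∉ U := by
        have := hd (p + 1) 0 (by omega) (φ (p + 1) z + w (p + 1))
          (by rw [add_sub_cancel_right]; exact hmem _ z hz)
        rwa [hw0, sub_zero] at this
      rw [hΦ p hp.le z hz, hg p hp _ (hmem p z hz), ← hΨ p hp z hz, Equiv.Perm.inv_def, Equiv.symm_apply_apply,
        hout _ h1, hg p hp z hz, hΦ (p + 1) hp z hz]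
    · push Not at h
      have h1 : Φ y = y := by
        by_cases hN : y - w N ∈ U
        · have := hΦ N le_rfl _ hN
          rwa [hφN, Equiv.Perm.one_apply, sub_add_cancel] at this
        · refine hΦ' y fun p hp => ?_
          rcases hp.lt_or_eq with hp | rfl
          exacts [h p hp, hN]
      have h2 : ∀ p < N, g y - w (p + 1) ∉ U := by
        intro p hp hu
        have h3 := hg p hp _ hu
        rw [sub_add_cancel] at h3
        have h4 := g.injective h3
        apply h p hp
        rwa [← h4, add_sub_cancel_right]
      have h3 : Ψ⁻¹ (g y) = g y := by
        rw [Equiv.Perm.inv_eq_iff_eq, hΨ' _ h2]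
      rw [h1, h3]
      by_cases h0 : g y ∈ U
      · have := hΦ 0 (Nat.zero_le _) _ h0
        rw [hw0, add_zero, add_zero] at this
        rw [this]
      · rw [hout _ h0, hΦ']
        rintro (_ | p) hp
        · rwa [hw0, sub_zero]
        · exact h2 p hp
  have h := congrArg (fun x => x * Φ⁻¹ * g⁻¹ * Ψ) key
  simpa [mul_assoc] using h

namespace HamIsotopy

/-- Translated copies of the intermediate maps of an isotopy, in one isotopy. -/
theorem exists_copies (J : HamIsotopy n) {U : Set (E n)} (hU : IsClosed U)
    (h : ∀ t, ∀ z ∉ U, J.H z t = 0) {w : ℕ → E n}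
    (hd : ∀ p q, p ≠ q → ∀ z, z - w p ∈ U → z - w q ∉ U) (N : ℕ) (c : ℕ → ℝ) :
    ∃ Φ : HamIsotopy n, (∀ p < N, ∀ z ∈ U, Φ.flow 1 (z + w p) = J.flow (c p) z + w p) ∧
      ∀ z, (∀ p < N, z - w p ∉ U) → Φ.flow 1 z = z := by
  obtain ⟨Φ, -, h1, h2⟩ := exists_disjointUnion (ι := Fin N)
    (fun p => (J.reparam (fun t => c p * t) (by fun_prop)).translate (w p))
    (S := fun p => {z | z - w p ∈ U})
    (fun p => hU.preimage (by fun_prop : Continuous fun z => z - w p))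
    (fun p q hpq z => hd p q (fun e => hpq (Fin.ext e)) z)
    (fun p t z hz => by
      rw [translate_H]
      exact (congrArg _ (h _ _ hz)).trans (mul_zero _))
  refine ⟨Φ, fun p hp z hz => ?_, fun z hz => h2 1 z fun p => hz p p.2⟩
  rw [h1 1 ⟨p, hp⟩ _ (by simpa using hz), translate_flow_apply]
  simp [reparam, J.flow_zero]

/-- Translated copies of short pieces of an isotopy, in one isotopy with small oscillations. -/
theorem exists_short_copies (J : HamIsotopy n) {U : Set (E n)} (hU : IsClosed U)
    (h : ∀ t, ∀ z ∉ U, J.H z t = 0) {w : ℕ → E n}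
    (hd : ∀ p q, p ≠ q → ∀ z, z - w p ∈ U → z - w q ∉ U) {N : ℕ} (hN : 0 < N) {k : ℕ} {M : ℝ}
    (hM : 0 ≤ M) (hb : ∀ t ∈ Icc (0 : ℝ) 1, ∀ i ≤ k, ∀ z, |iteratedDeriv i (J.H z) t| ≤ M) :
    ∃ Ψ : HamIsotopy n, Ψ.OscBound k (2 * (M / N)) (2 * (M / N)) ∧
      (∀ p < N, ∀ z ∈ U, Ψ.flow 1 (J.flow (1 - (p + 1 : ℕ) / N) z + w (p + 1))
        = J.flow (1 - p / N) z + w (p + 1)) ∧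
      ∀ z, (∀ p < N, z - w (p + 1) ∉ U) → Ψ.flow 1 z = z := by
  have hN0 : (0 : ℝ) < N := by exact_mod_cast hN
  have hN1 : (1 : ℝ) ≤ N := by exact_mod_cast hN
  -- The p-th piece runs through times 1 - (p+1)/N to 1 - p/N of J at speed 1/N.
  let ι : Fin N → HamIsotopy n := fun p => (J.reparam
    (fun t => (N : ℝ)⁻¹ * t + (1 - ((p : ℕ) + 1 : ℕ) / N)) (by fun_prop)).translate (w (p + 1))
  have hι : ∀ p z t, (ι p).H z t
      = (N : ℝ)⁻¹ * J.H (z - w (p + 1)) ((N : ℝ)⁻¹ * t + (1 - ((p : ℕ) + 1 : ℕ) / N)) := by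
    intro p z t
    have : deriv (fun t : ℝ => (N : ℝ)⁻¹ * t + (1 - ((p : ℕ) + 1 : ℕ) / N)) t = (N : ℝ)⁻¹ := by
      simp
    rw [translate_H]
    simp only [reparam, this]
  have hdι : ∀ p q : Fin N, p ≠ q → ∀ z, z ∈ {z | z - w (p + 1) ∈ U} →
      z ∉ {z | z - w (q + 1) ∈ U} := fun p q hpq z =>
    hd _ _ (fun e => hpq (Fin.ext (Nat.succ_injective e))) z
  have h0ι : ∀ (p : Fin N) t, ∀ z ∉ {z | z - w (p + 1) ∈ U}, (ι p).H z t = 0 :=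
    fun p t z hz => by
      have hz' : z - w (p + 1) ∉ U := hz
      rw [hι, h _ _ hz', mul_zero]
  obtain ⟨Ψ, h0, h1, h2⟩ := exists_disjointUnion ι (S := fun p => {z | z - w (p + 1) ∈ U})
    (fun p => hU.preimage (by fun_prop : Continuous fun z => z - w (p + 1))) hdι h0ι
  refine ⟨Ψ, oscBound_of_eq_sum ι hdι h0ι h0 (by positivity) fun p t ht i hi z => ?_,
    fun p hp z hz => ?_, fun z hz => h2 1 z fun p => hz p p.2⟩
  · have hp : (((p : ℕ) + 1 : ℕ) : ℝ) ≤ N := by exact_mod_cast p.2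
    have hp1 : (1 : ℝ) ≤ ((p : ℕ) + 1 : ℕ) := by simp
    have hmem : (N : ℝ)⁻¹ * t + (1 - ((p : ℕ) + 1 : ℕ) / N) ∈ Icc (0 : ℝ) 1 := by
      have e : (N : ℝ)⁻¹ * t + (1 - ((p : ℕ) + 1 : ℕ) / N)
          = (t + (N - ((p : ℕ) + 1 : ℕ))) / N := by
        field_simp
      rw [e]
      exact ⟨div_nonneg (by linarith [ht.1]) hN0.le, (div_le_one hN0).2 (by linarith [ht.2])⟩
    have e : (ι p).H z = fun t => (N : ℝ)⁻¹ * J.H (z - w (p + 1))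
      ((N : ℝ)⁻¹ * t + (1 - ((p : ℕ) + 1 : ℕ) / N)) := funext fun t => hι p z t
    rw [e, iteratedDeriv_comp_affine (J.smooth_H_time _), abs_mul, abs_mul, abs_pow,
      abs_of_nonneg (inv_nonneg.2 hN0.le)]
    have h3 : (N : ℝ)⁻¹ ^ i ≤ 1 := pow_le_one₀ (inv_nonneg.2 hN0.le) (inv_le_one_of_one_le₀ hN1)
    calc (N : ℝ)⁻¹ * (N : ℝ)⁻¹ ^ i * |iteratedDeriv i (J.H (z - w (p + 1))) _|
        ≤ (N : ℝ)⁻¹ * 1 * M := by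
          gcongr
          exact hb _ hmem i hi _
      _ = M / N := by ring
  · have hm := J.flow_mem hU h (1 - (p + 1 : ℕ) / N) hz
    rw [h1 1 ⟨p, hp⟩ _ (by simpa using hm), translate_flow_apply]
    have e : (N : ℝ)⁻¹ * 1 + (1 - (p + 1 : ℕ) / N) = 1 - p / N := by
      push_cast
      field_simp
      ring
    simp [reparam, ← e]

/-- Up to an arbitrarily small factor, a Hamiltonian diffeomorphism that is supported in strips in
a ball is the product of two time-one maps of autonomous flows with small oscillations. -/
theorem exists_displacement (J : HamIsotopy n) (i : Fin n) (z₀ : E n) {D W : ℝ} (o : ℝ)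
    (hD : 0 < D) (hW : 0 < W) (h : ∀ t, ∀ z ∉ strips i z₀ D W o, J.H z t = 0) (k : ℕ) {η : ℝ}
    (hη : 0 < η) :
    ∃ A B L : HamIsotopy n, J.flow 1 = A.flow 1 * B.flow 1 * L.flow 1 ∧
      A.OscBound k (5 / 2 * D * W * (9 / 8)) 0 ∧ B.OscBound k (5 / 2 * D * W * (9 / 8)) 0 ∧
      L.OscBound k η η := by
  set U := strips i z₀ D W o with hUdef
  have hU : IsClosed U := isClosed_strips i z₀ D W o
  obtain ⟨M, hM, hb⟩ := J.exists_bound_iteratedDeriv k 0 1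
  obtain ⟨N, hN⟩ := exists_nat_gt (2 * M / η)
  have hN0 : (0 : ℝ) < N := lt_of_le_of_lt (by positivity) hN
  have hN1 : 0 < N := by exact_mod_cast hN0
  have hMN : 2 * (M / N) ≤ η := by
    rw [div_lt_iff₀ hη] at hN
    rw [← mul_div_assoc, div_le_iff₀ hN0]
    linarith
  -- Any shift longer than 2D separates the translated balls; it is taken along the strips and so
  -- preserves them.
  set S : ℝ := 5 / 2 * D with hS
  set v : E n := S • EuclideanSpace.single (Sum.inr i) (1 : ℝ) with hv
  have hS0 : 0 < S := by positivity
  have hvn : ‖v‖ = S := by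
    rw [hv, norm_smul, PiLp.norm_single, norm_one, mul_one, Real.norm_of_nonneg hS0.le]
  have hvi : v (Sum.inl i) = 0 := by simp [hv]
  let w : ℕ → E n := fun p => (p : ℝ) • v
  have hd : ∀ p q, p ≠ q → ∀ z, z - w p ∈ U → z - w q ∉ U := by
    intro p q hpq z hp hq
    have h1 := dist_triangle_right (z - w p) (z - w q) z₀
    have h2 : dist (z - w p) (z - w q) = |(p : ℝ) - q| * S := by
      have : z - w p - (z - w q) = -(((p : ℝ) - q) • v) := by
        simp only [w]; module
      rw [dist_eq_norm, this, norm_neg, norm_smul, hvn, Real.norm_eq_abs]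
    have h3 : (1 : ℝ) ≤ |(p : ℝ) - q| := by
      have : (1 : ℤ) ≤ |(p : ℤ) - q| := Int.one_le_abs (by omega)
      exact_mod_cast this
    have h4 : dist (z - w p) z₀ ≤ D := hp.1
    have h5 : dist (z - w q) z₀ ≤ D := hq.1
    have h6 : S ≤ |(p : ℝ) - q| * S := le_mul_of_one_le_left hS0.le h3
    rw [h2] at h1
    linarith
  -- The radius covers all the copies that g has to move.
  obtain ⟨g, G, hgG, hG, hg⟩ := exists_shift i z₀ (R := D + N * S) (W := W) (S := S) o
    (by positivity) hW hS0.le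
  obtain ⟨Φ, hΦ, hΦ'⟩ := J.exists_copies hU h hd (N + 1) fun p => 1 - p / N
  obtain ⟨Ψ, hΨo, hΨ, hΨ'⟩ := J.exists_short_copies hU h hd hN1 hM hb
  have key := eq_commutator_mul (U := U) (w := w) (by simp [w]) hd (N := N)
    (φ := fun p => J.flow (1 - p / N)) (by rw [div_self hN0.ne', sub_self, J.flow_zero])
    (fun p z hz => J.flow_mem hU h _ hz) (fun z hz => J.flow_eq_self hU h _ hz)
    (g := g.flow 1) (Φ := Φ.flow 1) (Ψ := Ψ.flow 1)
    (fun p hp z hz => by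
      have hw : w (p + 1) = w p + v := by simp only [w]; push_cast; module
      rw [hg, hw, add_assoc]
      refine ⟨?_, ?_⟩
      · have h1 : ‖w p‖ ≤ N * S := by
          rw [norm_smul, hvn, Real.norm_of_nonneg (Nat.cast_nonneg p)]
          gcongr
        have h2 : dist z z₀ ≤ D := hz.1
        have h3 := dist_triangle (z + w p) z z₀
        rw [dist_eq_norm (z + w p) z, add_sub_cancel_left] at h3
        rw [Metric.mem_closedBall]
        linarith
      · have h1 : Int.fract (z (Sum.inl i) / W - o) ≤ 7 / 8 := hz.2
        simpa [w, hvi] using h1)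
    (fun p hp => hΦ p (by omega)) (fun z hz => hΦ' z fun p hp => hz p (by omega)) hΨ hΨ'
  have hc : S * W - -(S * W * (1 / 8)) = S * W * (9 / 8) := by ring
  -- A = Φ g Φ⁻¹ and B = g⁻¹, the latter as g run backwards. The isotopy of Φ is not part of the
  -- path; only its time-one map is used.
  refine ⟨g.conj (Φ.flow 1) (Φ.smooth_flow_slice 1) (Φ.smooth_symm_slice 1) 1
    fun z u v => by rw [one_mul]; exact Φ.omega0_D 1 z u v,
    g.reparam (fun t => -1 * t + 1) (by fun_prop), Ψ, ?_, ?_, ?_, ?_⟩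
  · have : J.flow 1 = J.flow (1 - (0 : ℕ) / N) := by simp
    rw [this]
    refine key.trans ?_
    congr 2
    simp [reparam, g.flow_zero]
  · rw [← hc]
    exact oscBound_of_autonomous (G := fun z => G ((Φ.flow 1).symm z))
      (fun z t => by simp [conj, hgG]) (fun z => hG _) k
  · have := oscBound_of_autonomous (L := g.reparam (fun t => -1 * t + 1) (by fun_prop))
      (G := fun z => -G z) (m := -(S * W)) (M := S * W * (1 / 8))
      (fun z t => by
        have : deriv (fun t : ℝ => -1 * t + 1) t = -1 := by simp
        simp only [reparam, this, hgG]
        ring) (fun z => ⟨by linarith [(hG z).2], by linarith [(hG z).1]⟩) k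
    rwa [show S * W * (1 / 8) - -(S * W) = S * W * (9 / 8) by ring] at this
  · exact fun t ht => ⟨(hΨo t ht).1.trans hMN, fun i hi => ((hΨo t ht).2 i hi).trans hMN⟩

/-! ### Fragmentation and assembly of the path -/

/-- A `C⁰`-small isotopy splits into two isotopies that are supported in parallel strips. -/
theorem exists_fragmentation (L : HamIsotopy n) (i : Fin n) (z₀ : E n) {D W : ℝ} (hW : 0 < W)
    (hm : ∀ t z, ‖L.flow t z - z‖ ≤ W / 4)
    (h : ∀ t, ∀ z ∉ Metric.closedBall z₀ D, L.H z t = 0) :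
    ∃ f₁ f₂ : HamIsotopy n, L.flow 1 = f₁.flow 1 * f₂.flow 1 ∧
      (∀ t, ∀ z ∉ strips i z₀ D W 0, f₁.H z t = 0) ∧
      ∀ t, ∀ z ∉ strips i z₀ D W (1 / 2), f₂.H z t = 0 := by
  let X : E n → ℝ := fun z => z (Sum.inl i) / W
  have hX : ContDiff ℝ ∞ X :=
    (EuclideanSpace.proj (Sum.inl i) : E n →L[ℝ] ℝ).contDiff.div_const W
  obtain ⟨K, hK, hK0⟩ := L.compact_H
  obtain ⟨f, hfH⟩ := exists_hamIsotopy (H := fun z t => stripCutoff (X z) * L.H z t)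
    (((contDiff_stripCutoff.comp hX).comp contDiff_fst).mul L.smooth_H) hK
    (fun t z hz => by rw [hK0 t z hz, mul_zero])
  have hf : ∀ z t, f.H z t = stripCutoff (X z) * L.H z t := fun z t => by rw [hfH]
  have hball : ∀ t, ∀ z ∉ Metric.closedBall z₀ D, f.H z t = 0 := fun t z hz => by
    rw [hf, h t z hz, mul_zero]
  have hmove : ∀ t z, |X (L.flow t z) - X z| ≤ 1 / 4 := fun t z => by
    have h1 : |(L.flow t z - z) (Sum.inl i)| ≤ ‖L.flow t z - z‖ := PiLp.norm_apply_le (L.flow t z - z) (Sum.inl i)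
    have h2 : X (L.flow t z) - X z = (L.flow t z - z) (Sum.inl i) / W := by
      simp only [X, PiLp.sub_apply]; ring
    rw [h2, abs_div, abs_of_pos hW, div_le_iff₀ hW]
    linarith [hm t z]
  refine ⟨f, f.invMul L, by simp [invMul], fun t z hz => ?_, fun t z hz => ?_⟩
  · by_cases hz' : z ∈ Metric.closedBall z₀ D
    · have h1 : 7 / 8 < Int.fract (X z) := by
        by_contra hn
        refine hz ⟨hz', ?_⟩
        show Int.fract (X z - 0) ≤ 7 / 8
        rw [sub_zero]
        exact not_lt.1 hn
      rw [hf, stripCutoff_eq_zero h1, zero_mul]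
    · exact hball t z hz'
  · show L.H (f.flow t z) t - f.H (f.flow t z) t = 0
    by_cases hz' : z ∈ Metric.closedBall z₀ D
    · have h1 : 7 / 8 < Int.fract (X z - 1 / 2) := by
        by_contra hn
        exact hz ⟨hz', not_lt.1 hn⟩
      have h2 := Int.floor_add_fract (X z - 1 / 2)
      have h3 := Int.fract_lt_one (X z - 1 / 2)
      -- Here X z lies in (m + 3/8, m + 1/2) and moves by at most 1/4. Along the orbit the cutoff is
      -- therefore 1, so f and L agree and f⁻¹L has Hamiltonian 0.
      set m : ℤ := ⌊X z - 1 / 2⌋ + 1 with hmdef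
      have hmc : (m : ℝ) = ⌊X z - 1 / 2⌋ + 1 := by rw [hmdef]; push_cast; rfl
      have hmem : ∀ s, X (L.flow s z) ∈ Ioo (m + 3 / 32 : ℝ) (m + 25 / 32) := fun s => by
        have := abs_le.1 (hmove s z)
        constructor <;> linarith [this.1, this.2]
      have h4 : ∀ s, (fun y => f.H y s) =ᶠ[𝓝 (L.flow s z)] fun y => L.H y s := fun s => by
        filter_upwards [hX.continuous.continuousAt.preimage_mem_nhds
          (Ioo_mem_nhds (hmem s).1 (hmem s).2)] with y hy
        rw [hf, stripCutoff_eq_one hy, one_mul]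
      have h5 := f.flow_eq_of_hasDerivAt (c := fun t => L.flow t z) (fun s => by
        rw [hamVF_congr (h4 s)]
        exact L.hasDerivAt z s) t
      simp only [L.flow_zero, Equiv.Perm.one_apply] at h5
      rw [h5, (h4 t).eq_of_nhds, sub_self]
    · rw [f.flow_eq_self Metric.isClosed_closedBall hball t hz', h t z hz', hball t z hz',
        sub_self]

theorem OscBound.mono {J : HamIsotopy n} {k : ℕ} {c η c' η' : ℝ} (h : J.OscBound k c η)
    (hc : c ≤ c') (hη : η ≤ η') : J.OscBound k c' η' := fun t ht =>
  ⟨(h t ht).1.trans hc, fun i hi => ((h t ht).2 i hi).trans hη⟩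

/-- Dilation by ε multiplies the Hamiltonian and all its time derivatives by ε², since time is not
rescaled. -/
theorem exists_oscBound_dilate (J : HamIsotopy n) (z₀ : E n) (k : ℕ) {η : ℝ} (hη : 0 < η) :
    ∃ (ε : ℝ) (hε : 0 < ε), ε ≤ 1 / 2 ∧ (J.dilate z₀ ε hε.ne').OscBound k η η := by
  obtain ⟨M, hM, hb⟩ := J.exists_bound_iteratedDeriv k 0 1
  have hε : 0 < min (1 / 2) (η / (2 * M + 1)) := by positivity
  refine ⟨_, hε, min_le_left _ _, ?_⟩
  set ε := min (1 / 2) (η / (2 * M + 1)) with hεdef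
  have h1 : ε ≤ 1 / 2 := min_le_left _ _
  have h2 : ε * (2 * M + 1) ≤ η := (le_div_iff₀ (by positivity)).1 (min_le_right _ _)
  have h3 : ε ^ 2 ≤ ε := by nlinarith
  have h4 := oscBound_of_eq_sum (ι := Unit) (fun _ => J.dilate z₀ ε hε.ne') (S := fun _ => univ)
    (fun p q hpq => absurd (Subsingleton.elim p q) hpq) (fun _ _ z hz => absurd (mem_univ z) hz)
    (L := J.dilate z₀ ε hε.ne') (fun z t => by simp) (k := k) (M := ε * M) (by positivity)
    (fun _ t ht i hi z => by
      have e : (J.dilate z₀ ε hε.ne').H z = fun t =>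
          ε ^ 2 * J.H ((dilation z₀ ε hε.ne').symm z) (1 * t + 0) := by
        ext1 t
        rw [one_mul, add_zero]
        rfl
      rw [e, iteratedDeriv_comp_affine (J.smooth_H_time _), one_pow, mul_one, one_mul, add_zero,
        abs_mul, abs_of_nonneg (sq_nonneg ε)]
      exact mul_le_mul h3 (hb t ht i hi _) (abs_nonneg _) hε.le)
  have h5 : 2 * (ε * M) ≤ η := by linarith
  exact h4.mono h5 h5

/-- The estimate of the quasimetric in terms of a ball that contains the support and of the
`C⁰`-distance to the identity. -/
theorem dStar_flow_mul_le (J : HamIsotopy n) (i : Fin n) (z₀ : E n) {D δ : ℝ} (hD : 0 < D)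
    (hδ : 0 < δ) (hsupp : ∀ z ∉ Metric.closedBall z₀ D, J.flow 1 z = z)
    (hδJ : ∀ z, ‖J.flow 1 z - z‖ ≤ δ) (k : ℕ) {φ : Equiv.Perm (E n)} (hφ : φ ∈ Ham n) :
    dStar k φ (J.flow 1 * φ) ≤ ENNReal.ofReal (128 * D * δ) := by
  have hDδ : 0 < D * δ := mul_pos hD hδ
  -- Seven pieces at speed 7: with this η, the orders 1 to k cost at most Dδ altogether.
  let η : ℝ := D * δ / (k * 7 ^ (k + 1) + 1)
  have hk : (0 : ℝ) ≤ k * 7 ^ (k + 1) := by positivity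
  have hη : 0 < η := by positivity
  have hη1 : η * (k * 7 ^ (k + 1) + 1) = D * δ := div_mul_cancel₀ _ (by positivity)
  have hη2 : η ≤ D * δ := div_le_self hDδ.le (by linarith)
  obtain ⟨ε, hε, hε2, hosc⟩ := J.exists_oscBound_dilate z₀ k hη
  obtain ⟨L, hL, hLm, hL0⟩ := exists_small_isotopy J i z₀ hD.le hsupp hδJ hε (by linarith)
  -- Since ε ≤ 1/2, the displacement is at most 3δ/2 = W/4.
  obtain ⟨f₁, f₂, hf, h₁, h₂⟩ := L.exists_fragmentation i z₀ (D := D) (W := 6 * δ) (by positivity)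
    (fun t z => (hLm t z).trans (by nlinarith)) hL0
  obtain ⟨A₁, B₁, C₁, e₁, hA₁, hB₁, hC₁⟩ := f₁.exists_displacement i z₀ 0 hD (by positivity) h₁ k hη
  obtain ⟨A₂, B₂, C₂, e₂, hA₂, hB₂, hC₂⟩ :=
    f₂.exists_displacement i z₀ (1 / 2) hD (by positivity) h₂ k hη
  set c : ℝ := 5 / 2 * D * (6 * δ) * (9 / 8) with hc
  have hηc : η ≤ c := by
    rw [hc]; linarith
  -- Maps compose on the left, so the rightmost factor of A₁B₁C₁A₂B₂C₂θ_ε is carried out first.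
  let ι : ℕ → HamIsotopy n
    | 0 => J.dilate z₀ ε hε.ne'
    | 1 => C₂
    | 2 => B₂
    | 3 => A₂
    | 4 => C₁
    | 5 => B₁
    | _ => A₁
  have hι : ∀ l < 7, (ι l).OscBound k c η := by
    intro l hl
    interval_cases l
    exacts [hosc.mono hηc le_rfl, hC₂.mono hηc le_rfl, hB₂.mono le_rfl hη.le,
      hA₂.mono le_rfl hη.le, hC₁.mono hηc le_rfl, hB₁.mono le_rfl hη.le, hA₁.mono le_rfl hη.le]
  have hend : partialProduct ι φ 7 = J.flow 1 * φ := by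
    rw [← hL, hf, e₁, e₂]
    simp only [partialProduct, ι, mul_assoc]
  have hlen := lengthStar_concat_le ι hφ (N := 7) (by norm_num) k (by positivity) hη.le hι
  rw [← hend]
  refine (iInf_le _ (concat ι hφ (N := 7) (by norm_num))).trans (hlen.trans
    (ENNReal.ofReal_le_ofReal ?_))
  push_cast
  have : (k : ℝ) * (7 ^ (k + 1) * η) ≤ D * δ := by
    rw [← hη1]
    linarith
  -- Numerically 7 · (5/2) · 6 · (9/8) + 1 = 119.125 ≤ 128.
  rw [hc]
  linarith

end HamIsotopy

/-! ### The estimate for a pair of Hamiltonian diffeomorphisms -/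

theorem dStar_self (k : ℕ) {φ : Equiv.Perm (E n)} (hφ : φ ∈ Ham n) : dStar k φ φ = 0 := by
  have h := HamIsotopy.lengthStar_concat_le (fun _ => HamIsotopy.const n) hφ (N := 1) one_pos k
    (c := 0) (η := 0) le_rfl le_rfl (fun l _ =>
      ((HamIsotopy.oscBound_of_autonomous (L := HamIsotopy.const n) (G := fun _ => 0) (m := 0)
        (M := 0) (fun _ _ => rfl) (fun _ => ⟨le_rfl, le_rfl⟩) k)).mono (by simp) le_rfl)
  have hend : HamIsotopy.partialProduct (fun _ => HamIsotopy.const n) φ 1 = φ := by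
    simp [HamIsotopy.partialProduct, HamIsotopy.const]
  have h2 : dStar k φ (HamIsotopy.partialProduct (fun _ => HamIsotopy.const n) φ 1) ≤ 0 := by
    refine (iInf_le _ _).trans (h.trans ?_)
    simp
  rw [hend] at h2
  exact le_antisymm h2 (zero_le)

theorem dStar_eq_normStar (k : ℕ) (φ : Equiv.Perm (E n)) {ψ : Equiv.Perm (E n)} (hψ : ψ ∈ Ham n) :
    dStar k φ ψ = normStar k (φ * ψ⁻¹) := by
  rw [normStar, ← dStar_mulRight k φ ψ (Ham.inv hψ), mul_inv_cancel]

theorem dStar_le (k : ℕ) {φ ψ : Equiv.Perm (E n)} (hφ : φ ∈ Ham n) (hψ : ψ ∈ Ham n) :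
    dStar k φ ψ ≤ ENNReal.ofReal (128 * Metric.diam (supp (φ * ψ⁻¹)) * distC0 φ ψ) := by
  by_cases hne : φ = ψ
  · subst hne
    rw [dStar_self k hφ]
    exact zero_le
  -- The path from φ to ψ requires ψφ⁻¹, the inverse of φψ⁻¹, which moves the same points. A moved
  -- point z₀ makes diameter and distance positive and rules out n = 0.
  obtain ⟨J, hJ⟩ := mem_Ham_iff.1 (Ham.mul hψ (Ham.inv hφ))
  have hend : J.flow 1 * φ = ψ := by rw [hJ, inv_mul_cancel_right]
  have hmoved : ∀ z, J.flow 1 z ≠ z → z ∈ supp (φ * ψ⁻¹) := fun z hz => by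
    refine subset_closure fun h => hz ?_
    rw [hJ, show ψ * φ⁻¹ = (φ * ψ⁻¹)⁻¹ by group, Equiv.Perm.inv_eq_iff_eq, h]
  have hmoved' : ∀ z, J.flow 1 z ≠ z → J.flow 1 z ∈ supp (φ * ψ⁻¹) := fun z hz =>
    hmoved _ fun h => hz ((J.flow 1).injective h)
  have hbdd : Bornology.IsBounded (supp (φ * ψ⁻¹)) := by
    obtain ⟨K, hK, hK0⟩ := J.compact_H
    refine hK.isBounded.subset (closure_minimal (fun z hz => ?_) hK.isClosed)
    by_contra hzK
    refine hz ?_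
    have h := J.flow_eq_self hK.isClosed hK0 1 hzK
    rw [hJ, show ψ * φ⁻¹ = (φ * ψ⁻¹)⁻¹ by group, Equiv.Perm.inv_eq_iff_eq] at h
    exact h.symm
  obtain ⟨z₀, hz₀⟩ : ∃ z, J.flow 1 z ≠ z := by
    by_contra! h
    refine hne ?_
    have : J.flow 1 = 1 := Equiv.ext h
    rw [← hend, this, one_mul]
  obtain ⟨i⟩ : Nonempty (Fin n) := by
    by_contra h
    rw [not_nonempty_iff] at h
    exact hz₀ (Subsingleton.elim _ _)
  have hdist : ∀ z, ‖J.flow 1 z - z‖ ≤ Metric.diam (supp (φ * ψ⁻¹)) := fun z => by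
    by_cases hz : J.flow 1 z = z
    · rw [hz, sub_self, norm_zero]
      exact Metric.diam_nonneg
    · rw [← dist_eq_norm]
      exact Metric.dist_le_diam_of_mem hbdd (hmoved' z hz) (hmoved z hz)
  have hδ : ∀ z, ‖J.flow 1 z - z‖ ≤ distC0 φ ψ := fun z => by
    -- A real supremum is meaningful only for a bounded family; the diameter of the support provides
    -- the bound.
    have hb : BddAbove (range fun z => ‖φ z - ψ z‖) := by
      refine ⟨Metric.diam (supp (φ * ψ⁻¹)), forall_mem_range.2 fun y => ?_⟩
      rw [norm_sub_rev, ← show J.flow 1 (φ y) = ψ y from DFunLike.congr_fun hend y]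
      exact hdist (φ y)
    have h := le_ciSup hb (φ⁻¹ z)
    rw [norm_sub_rev] at h
    rw [hJ]
    simpa [distC0] using h
  have hpos : 0 < ‖J.flow 1 z₀ - z₀‖ := norm_pos_iff.2 (sub_ne_zero.2 hz₀)
  have hmain := J.dStar_flow_mul_le i z₀ (hpos.trans_le (hdist z₀)) (hpos.trans_le (hδ z₀))
    (fun z hz => by
      by_contra hz'
      exact hz (Metric.dist_le_diam_of_mem hbdd (hmoved z hz') (hmoved z₀ hz₀))) hδ k hφ
  rwa [hend] at hmain

end HamGeom

end

theorem mainTheorem7 (k : ℕ) :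
    ∃ C : ℝ,
      C ≤ 2 ^ (3 * k + 8) * ((k : ℝ) + 1) ^ 2 *
          (1 + 2 ^ (k + 1) + 2 ^ (2 * k + 2) + 2 ^ (3 * k + 3)) ∧
      (k = 0 → C = 128) ∧
      ∀ (n : ℕ) (φ ψ : Equiv.Perm (HamGeom.E n)),
        φ ∈ HamGeom.Ham n → ψ ∈ HamGeom.Ham n →
          HamGeom.dStar k φ ψ = HamGeom.normStar k (φ * ψ⁻¹) ∧
          HamGeom.dStar k φ ψ ≤
            ENNReal.ofReal
              (C * Metric.diam (HamGeom.supp (φ * ψ⁻¹)) * HamGeom.distC0 φ ψ) := by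
  -- The value 128 = 2^7 works for all `k` and lies below the stated bound factor by factor.
  refine ⟨128, ?_, fun _ => rfl, fun n φ ψ hφ hψ =>
    ⟨HamGeom.dStar_eq_normStar k φ hψ, HamGeom.dStar_le k hφ hψ⟩⟩
  have h1 : (2 : ℝ) ^ 7 ≤ 2 ^ (3 * k + 8) := pow_le_pow_right₀ (by norm_num) (by omega)
  have h2 : (1 : ℝ) ≤ ((k : ℝ) + 1) ^ 2 := one_le_pow₀ (by linarith [Nat.cast_nonneg (α := ℝ) k])
  have h3 : (1 : ℝ) ≤ 1 + 2 ^ (k + 1) + 2 ^ (2 * k + 2) + 2 ^ (3 * k + 3) := by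
    have : (0 : ℝ) ≤ 2 ^ (k + 1) + 2 ^ (2 * k + 2) + 2 ^ (3 * k + 3) := by positivity
    linarith
  calc (128 : ℝ) = 2 ^ 7 * 1 * 1 := by norm_num
    _ ≤ _ := by gcongr
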